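/- **Setting.** Let $d,N\ge 1$ be integers, $p\in(1,\infty)$, $1/p+1/q=1$, and let $D\subset\mathbb R^d$ be bounded, with $\|u\|\le M$ for all $u\in D$ ($\|\cdot\|$ is the Euclidean norm; $|||\cdot|||$ denotes operator norms). Let $\mathcal I\subset D^{\mathbb Z_-}$ be a set of inputs $z=(z_t)_{t\le 0}$. Let $\sigma_2:\mathbb R\to\mathbb R$ be Lipschitz with constant $L_{\sigma_2}$. Write $\mathcal X=\mathbb R\times\ell^p\times\mathbb R^d\times\mathbb R$, $\mathcal X^N=\mathbb R\times\mathbb R^N\times\mathbb R^d\times\mathbb R$, with points $(w,a,c,b)$, and $a\cdot x=\sum_i a_ix_i$. **Target.** Let $H:\mathcal I\to\mathbb R$ be a recurrent Barron functional with linear state equation: there are a Borel probability measure $\mu$ on $\mathcal X$, $B\in\ell^q$ and bounded linear maps $A:\ell^q\to\ell^q$, $C:\mathbb R^d\to\ell^q$ such that for each $z\in\mathcal I$ the system $x_t=Ax_{t-1}+Cz_t+B$ ($t\le 0$) has a unique solution $(x_t(z))_{t\le 0}$ bounded in $\ell^q$, $I_{\mu,p}=\int|w|(\|a\|_p+\|c\|+|b|)\,d\mu<\infty$,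 and $$H(z)=\int_{\mathcal X} w\,\sigma_2\big(a\cdot x_{-1}(z)+c\cdot z_0+b\big)\,\mu(dw,da,dc,db),\qquad z\in\mathcal I .$$ Assume $|||A|||<1$ and $I^{(2)}_{\mu,p}=\big(\int w^2(\|a\|_p^2+\|c\|^2+|b|^2+1)\,d\mu\big)^{1/2}<\infty$, and let $\lambda\in(|||A|||,1)$. **ESN–ELM.** Let $T=\lceil N/d\rceil$ and let $A^{E}\in\mathbb R^{N\times N}$, $C^{E}\in\mathbb R^{N\times d}$, $B^{E}\in\mathbb R^N$ be (a realization of) the parameters of an echo state network with $|||A^{E}|||<1$ and such that the matrix $K\in\mathbb R^{N\times N}$ formed by the first $N$ columns of $(C^{E}\,|\,A^{E}C^{E}\,|\cdots|\,(A^{E})^{T-1}C^{E})$ is invertible. Let $\Lambda\in\mathbb R^{N\times N}$ be diagonal with $\Lambda_{d(k-1)+j,\,d(k-1)+j}=\lambda^{k-1}$ ($k\ge1$, $1\le j\le d$). For $a\in\ell^p$ let $\pi\bar{\mathcal L}(a)\in\mathbb R^N$ have the entries $[\pi\bar{\mathcal L}(a)]_{d(k-1)+j}=\big[((\lambda^{-1}A)^{k-1}C)^*a\big]_j$,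 put $v(a)=K^{-\top}\Lambda\,\pi\bar{\mathcal L}(a)$, and let $\mu_{A,B,C}$ be the push-forward of $\mu$ under $$(w,a,c,b)\mapsto\Big(w,\;v(a),\;c,\;-v(a)\cdot\sum_{k=1}^{T}(A^{E})^{k-1}B^{E}+a\cdot\sum_{k=0}^\infty A^kB+b\Big)\in\mathcal X^N .$$ Let $(w^{(i)},a^{(i)},c^{(i)},b_i)$, $i=1,\dots,N$, be i.i.d. random elements of $\mathcal X^N$ with law $\nu$, and suppose that $\mu_{A,B,C}\ll\nu$ and that $d\mu_{A,B,C}/d\nu$ is ($\nu$-essentially) bounded. **Conclusion.** For every $z\in\mathcal I$ the network equation $x^{E}_t=A^{E}x^{E}_{t-1}+C^{E}z_t+B^{E}$ ($t\le0$) has a unique bounded solution, and there is a measurable $f:(\mathcal X^N)^N\to\mathbb R^N$ (independent of $z$) such that, with $W=f\big((w^{(i)},a^{(i)},c^{(i)},b_i)_{i=1,\dots,N}\big)$ and $$\widehat H(z)=\sum_{i=1}^N W_i\,\sigma_2\big(a^{(i)}\cdot x^{E}_{-1}(z)+c^{(i)}\cdot z_0+b_i\big),$$ one has for all $z\in\mathcal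 I$ $$\mathbb E\big[|H(z)-\widehat H(z)|^2\big]^{1/2}\le C_{H,\mathrm{ESN}}\Big[\lambda^{N/d}+|||A^{E}|||^{T}+\frac1{N^{1/2}}\Big\|\frac{d\mu_{A,B,C}}{d\nu}\Big\|_\infty^{1/2}\Big],$$ where $$C_{H,\mathrm{ESN}}=\tilde c_1\max\Big(\frac{|||C|||}{(1-|||\lambda^{-1}A|||^p)^{1/p}},\frac{\|B\|_q}{1-|||A|||},1\Big)\max\big(I_{\mu,p},I^{(2)}_{\mu,p}\big)\Big(1+\frac{|||C^{E}|||+\|B^{E}\|}{1-|||A^{E}|||}\,|||K^{-\top}\Lambda|||\Big)$$ and $\tilde c_1$ depends only on $d,\sigma_2,p,M,\lambda$, namely $$\tilde c_1=8^{1/2}\max(L_{\sigma_2},|\sigma_2(0)|,1)\,\max(1,d^{\frac12-\frac1p})\,d^{\frac1{2p}}\,\max(1,d^{\frac1q-\frac12})\,(1-\lambda)^{-1}(1-\lambda^q)^{-1/q}\lambda^{-1}\max(M,1)^2 .$$ -/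

import Mathlib

open MeasureTheory ProbabilityTheory
open scoped ENNReal NNReal Matrix.Norms.L2Operator

noncomputable section

/-- The space `ℓ^p` of real sequences, with its usual norm. -/
abbrev SeqSpace (p : ℝ≥0∞) : Type := lp (fun _ : ℕ => ℝ) p

/-- `ℓ^p` carries its Borel σ-algebra. -/
instance instMeasurableSpaceSeqSpace (p : ℝ≥0∞) [Fact (1 ≤ p)] : MeasurableSpace (SeqSpace p) :=
  borel _

instance instBorelSpaceSeqSpace (p : ℝ≥0∞) [Fact (1 ≤ p)] : BorelSpace (SeqSpace p) := ⟨rfl⟩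

/-- `ℝ^n` with the Euclidean norm. -/
abbrev Vec (n : ℕ) : Type := EuclideanSpace ℝ (Fin n)

/-- The parameter space `𝒳 = ℝ × ℓ^p × ℝ^d × ℝ`, with points `(w, a, c, b)`. -/
abbrev ParamSpace (p : ℝ≥0∞) (d : ℕ) : Type := ℝ × SeqSpace p × Vec d × ℝ

/-- The parameter space `𝒳^N = ℝ × ℝ^N × ℝ^d × ℝ`, with points `(w, a, c, b)`. -/
abbrev FinParamSpace (N d : ℕ) : Type := ℝ × Vec N × Vec d × ℝ

/-- Semi-infinite inputs `(z_t)_{t ≤ 0}` in `ℝ^d`. Time is reversed: `z n` stands for `z_{-n}`.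
The same convention is used for sequences of states. -/
abbrev InputSeq (d : ℕ) : Type := ℕ → Vec d

/-- The pairing `a · x = ∑ i, a_i x_i` of two sequences. -/
def seqDot {p q : ℝ≥0∞} (a : SeqSpace p) (x : SeqSpace q) : ℝ := ∑' i, a i * x i

/-- `x ∈ ℓ^∞_-(ℓ^q)` solves `x_t = σ₁(A x_{t-1} + C z_t + B)`, `t ≤ 0`, where `σ₁` acts
componentwise. -/
structure IsSeqState (σ₁ : ℝ → ℝ) {q : ℝ≥0∞} [Fact (1 ≤ q)] {d : ℕ}
    (A : SeqSpace q →ₗ[ℝ] SeqSpace q) (B : SeqSpace q) (C : Vec d →ₗ[ℝ] SeqSpace q)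
    (z : InputSeq d) (x : ℕ → SeqSpace q) : Prop where
  bounded : ∃ R : ℝ, ∀ n, ‖x n‖ ≤ R
  step : ∀ n i, x n i = σ₁ ((A (x (n + 1)) + C (z n) + B) i)

/-- `I_{μ,p} = ∫ |w| (‖a‖_p + ‖c‖ + |b|) dμ`. -/
def barronMoment {p : ℝ≥0∞} [Fact (1 ≤ p)] {d : ℕ} (μ : Measure (ParamSpace p d)) : ℝ≥0∞ :=
  ∫⁻ θ, ‖θ.1‖ₑ * (‖θ.2.1‖ₑ + ‖θ.2.2.1‖ₑ + ‖θ.2.2.2‖ₑ) ∂μ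

/-- `I_{μ,p}^{(2)} = (∫ w² (‖a‖_p² + ‖c‖² + |b|² + 1) dμ)^{1/2}`. -/
def barronMoment₂ {p : ℝ≥0∞} [Fact (1 ≤ p)] {d : ℕ} (μ : Measure (ParamSpace p d)) : ℝ≥0∞ :=
  (∫⁻ θ, ‖θ.1‖ₑ ^ 2 * (‖θ.2.1‖ₑ ^ 2 + ‖θ.2.2.1‖ₑ ^ 2 + ‖θ.2.2.2‖ₑ ^ 2 + 1) ∂μ) ^ (1 / 2 : ℝ)

/-- The functional `H`, on the set `I` of inputs, is a recurrent (generalized) Barron functional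
with the realization `(μ, A, B, C)`. A functional belongs to the class `𝒞` exactly when such a
quadruple exists. -/
structure IsBarronRealization (σ₁ σ₂ : ℝ → ℝ) {p q : ℝ≥0∞} [Fact (1 ≤ p)] [Fact (1 ≤ q)] {d : ℕ}
    (I : Set (InputSeq d)) (H : InputSeq d → ℝ) (μ : Measure (ParamSpace p d))
    (A : SeqSpace q →ₗ[ℝ] SeqSpace q) (B : SeqSpace q) (C : Vec d →ₗ[ℝ] SeqSpace q) : Prop where
  isProbabilityMeasure : IsProbabilityMeasure μ
  existsUnique_state : ∀ z ∈ I, ∃! x : ℕ → SeqSpace q, IsSeqState σ₁ A B C z x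
  moment_lt_top : barronMoment μ < ∞
  repr : ∀ z ∈ I, ∀ x : ℕ → SeqSpace q, IsSeqState σ₁ A B C z x →
    H z = ∫ θ, θ.1 * σ₂ (seqDot θ.2.1 (x 1) + inner ℝ θ.2.2.1 (z 0) + θ.2.2.2) ∂μ

/-- Parameters of an echo state network with `N` neurons and inputs in `ℝ^d`. -/
structure ESN (N d : ℕ) where
  A : Matrix (Fin N) (Fin N) ℝ
  B : Vec N
  C : Matrix (Fin N) (Fin d) ℝ

/-- `x ∈ ℓ^∞_-(ℝ^N)` solves `x_t = σ₁(A^ESN x_{t-1} + C^ESN z_t + B^ESN)`, `t ≤ 0`, where `σ₁`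
acts componentwise. -/
structure ESN.IsState {N d : ℕ} (E : ESN N d) (σ₁ : ℝ → ℝ) (z : InputSeq d) (x : ℕ → Vec N) :
    Prop where
  bounded : ∃ R : ℝ, ∀ n, ‖x n‖ ≤ R
  step : ∀ n i, x n i = σ₁ ((E.A.toEuclideanLin (x (n + 1)) + E.C.toEuclideanLin (z n) + E.B) i)

/-- `T = ⌈N / d⌉`. -/
def horizon (N d : ℕ) : ℕ := ⌈(N : ℝ) / d⌉₊

/-- The Kalman controllability matrix: the first `N` columns of
`(C | A C | ⋯ | A^{T-1} C)` with `A = A^ESN`, `C = C^ESN`. With columns numbered from `0`, column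
`d k + j` (`0 ≤ j < d`) is column `j` of `A^k C`. -/
def ESN.K {N d : ℕ} [NeZero d] (E : ESN N d) : Matrix (Fin N) (Fin N) ℝ :=
  Matrix.of fun r i => (E.A ^ ((i : ℕ) / d) * E.C) r (Fin.ofNat d i)

/-- The diagonal matrix `Λ`, with entry `lam ^ k` at position `d k + j` (`0 ≤ j < d`, counting
from `0`). -/
def scalingMatrix (N d : ℕ) (lam : ℝ) : Matrix (Fin N) (Fin N) ℝ :=
  Matrix.diagonal fun i => lam ^ ((i : ℕ) / d)

/-- The matrix `K^{-⊤} Λ`. -/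
def ESN.KinvTΛ {N d : ℕ} [NeZero d] (E : ESN N d) (lam : ℝ) : Matrix (Fin N) (Fin N) ℝ :=
  E.K⁻¹.transpose * scalingMatrix N d lam

/-- The sequence `L̄(a)`: counting from `0`, its entry `d k + j` is
`[((lam⁻¹ A)^k C)^* a]_j = a · ((lam⁻¹ A)^k C e_j)`, with `e_j` the standard basis of `ℝ^d`. -/
def Lbar {p q : ℝ≥0∞} [Fact (1 ≤ p)] [Fact (1 ≤ q)] {d : ℕ} [NeZero d]
    (A : SeqSpace q →L[ℝ] SeqSpace q) (C : Vec d →L[ℝ] SeqSpace q) (lam : ℝ)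
    (a : SeqSpace p) (i : ℕ) : ℝ :=
  seqDot a (((lam⁻¹ • A) ^ (i / d)) (C (EuclideanSpace.single (Fin.ofNat d i) 1)))

/-- The map `ψ_{A,B,C} : 𝒳 → 𝒳^N`. -/
def psi {p q : ℝ≥0∞} [Fact (1 ≤ p)] [Fact (1 ≤ q)] {N d : ℕ} [NeZero d] (E : ESN N d)
    (A : SeqSpace q →L[ℝ] SeqSpace q) (B : SeqSpace q) (C : Vec d →L[ℝ] SeqSpace q) (lam : ℝ)
    (θ : ParamSpace p d) : FinParamSpace N d :=
  let v : Vec N :=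
    (E.KinvTΛ lam).toEuclideanLin (WithLp.toLp 2 fun i : Fin N => Lbar A C lam θ.2.1 i)
  (θ.1, v, θ.2.2.1,
    -inner ℝ v (∑ k ∈ Finset.range (horizon N d), (E.A ^ k).toEuclideanLin E.B)
      + seqDot θ.2.1 (∑' k : ℕ, (A ^ k) B) + θ.2.2.2)

/-- The push-forward `μ_{A,B,C} = μ ∘ ψ_{A,B,C}⁻¹`. -/
def muABC {p q : ℝ≥0∞} [Fact (1 ≤ p)] [Fact (1 ≤ q)] {N d : ℕ} [NeZero d] (E : ESN N d)
    (μ : Measure (ParamSpace p d)) (A : SeqSpace q →L[ℝ] SeqSpace q) (B : SeqSpace q)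
    (C : Vec d →L[ℝ] SeqSpace q) (lam : ℝ) : Measure (FinParamSpace N d) :=
  μ.map (psi E A B C lam)

/-- The output `∑ i, W_i σ₂(a⁽ⁱ⁾ · x + c⁽ⁱ⁾ · z₀ + b_i)` of the extreme learning machine with
weights `θ i = (w⁽ⁱ⁾, a⁽ⁱ⁾, c⁽ⁱ⁾, b_i)` (whose first entry is not used) and readout `W`; here
`x` is the state at time `-1`. -/
def elmOutput (σ₂ : ℝ → ℝ) {N d : ℕ} (W : Fin N → ℝ) (θ : Fin N → FinParamSpace N d)
    (x : Vec N) (z₀ : Vec d) : ℝ :=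
  ∑ i, W i * σ₂ (inner ℝ (θ i).2.1 x + inner ℝ (θ i).2.2.1 z₀ + (θ i).2.2.2)

/-- The constant `c̃₁`; `L` is a Lipschitz constant of `σ₂`, `s₀ = σ₂ 0`, and `M` bounds the
norm on the input set. -/
def cTilde (d : ℕ) (L s₀ p q M lam : ℝ) : ℝ :=
  (8 : ℝ) ^ (1 / 2 : ℝ) * max (max L |s₀|) 1 * max 1 ((d : ℝ) ^ (1 / 2 - 1 / p))
    * (d : ℝ) ^ (1 / (2 * p)) * max 1 ((d : ℝ) ^ (1 / q - 1 / 2))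
    * (1 - lam)⁻¹ * (1 - lam ^ q) ^ (-(1 / q)) * lam⁻¹ * max M 1 ^ 2

/-- The constant `C_{H,ESN}`. -/
def constHESN {p q : ℝ≥0∞} [Fact (1 ≤ p)] [Fact (1 ≤ q)] {N d : ℕ} [NeZero d] (E : ESN N d)
    (μ : Measure (ParamSpace p d)) (A : SeqSpace q →L[ℝ] SeqSpace q) (B : SeqSpace q)
    (C : Vec d →L[ℝ] SeqSpace q) (L s₀ M lam : ℝ) : ℝ :=
  cTilde d L s₀ p.toReal q.toReal M lam
    * max (max (‖C‖ / (1 - ‖lam⁻¹ • A‖ ^ p.toReal) ^ (1 / p.toReal)) (‖B‖ / (1 - ‖A‖))) 1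
    * max (barronMoment μ).toReal (barronMoment₂ μ).toReal
    * (1 + (‖E.C‖ + ‖E.B‖) / (1 - ‖E.A‖) * ‖E.KinvTΛ lam‖)

end

/-! ### Linear state equations in a Banach space -/

section LinearSystem

variable {F G : Type*} [NormedAddCommGroup F] [NormedSpace ℝ F]
  [NormedAddCommGroup G] [NormedSpace ℝ G]

/-! Write `T = ⌈N/d⌉`. Unrolling both linear systems from time `-1` shows each state as a linear
image of the first `N` scalar inputs, plus a constant and a remainder. In the network that image is
`K ζ`. Since `K^⊤ K^{-⊤} Λ = Λ` and `Λ` cancels the powers of `λ⁻¹` in `L̄(a)`, the vector `v(a)`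
satisfies `v(a) · K ζ = a · ∑ ζ_i A^k C e_j`. The bias of `psi` removes the contribution of `B^E`
and restores that of `B`, so the arguments of the two neurons differ only by remainders
(`abs_psi_arg_sub_le`). As `d` need not divide `N`, block `T - 1` may be incomplete, and the
remainders decay only like `‖A‖^(T-1)` and `‖v(a)‖ ‖A^E‖^(T-1)`.

Hence `H` is, up to a bias, the integral of a neuron against `κ = μ_{A,B,C}`. With readout `W_i =
N⁻¹ (dκ/dν)(θ_i) w_i` the random network is the importance sampling estimator of that integral, with
variance at most `‖dκ/dν‖_∞ / N` times a second moment (`importance_sampling_mse_le`).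

The remaining difficulty is to reach the stated constant. The Euclidean norm of `v(a)` costs a
factor `T^γ`, `γ = max(0, 1/2 - 1/p)`, and `‖A^E‖^(T-1)` is not a fixed multiple of `‖A^E‖^T`;
neither loss appears in the claim. Put `Γ = (‖C^E‖ + ‖B^E‖) / (1 - ‖A^E‖) · ‖K^{-⊤} Λ‖`, let `τ` be
the bracket of the claimed rate and `D` the factor of `c̃₁` depending on `d`. If `(1 + Γ) τ D ≥
19/20`, the claimed bound already exceeds a bound for `|H|`, and the zero readout works. Otherwise
`Γ D ≲ √N`, and `Γ ≥ 1 / (1 - ‖A^E‖)` (`one_le_norm_KinvTΛ_mul_norm_C`) keeps `‖A^E‖` away from `1`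
quantitatively. Then `T ‖A^E‖^(T-1) ≲ √d`, and `T^γ` is absorbed into `D` and a term `N^{-1/2}`
(`rpow_mul_pow_pred_le`). -/

theorem ContinuousLinearMap.norm_pow_apply_le (A : F →L[ℝ] F) (k : ℕ) (y : F) :
    ‖(A ^ k) y‖ ≤ ‖A‖ ^ k * ‖y‖ := by
  induction k with
  | zero => simp
  | succ k ih =>
    rw [pow_succ', mul_apply_eq_comp]
    calc ‖A ((A ^ k) y)‖ ≤ ‖A‖ * ‖(A ^ k) y‖ := A.le_opNorm _
      _ ≤ ‖A‖ * (‖A‖ ^ k * ‖y‖) := by gcongr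
      _ = ‖A‖ ^ (k + 1) * ‖y‖ := by ring

/-- Boundedness makes `S = sup ‖x n‖` finite, and the equation gives `S ≤ ‖A‖ S + U`, which can be
solved for `S`. -/
theorem norm_le_of_bounded_state {A : F →L[ℝ] F} (hA : ‖A‖ < 1) {x u : ℕ → F}
    (hx : ∃ R : ℝ, ∀ n, ‖x n‖ ≤ R) (step : ∀ n, x n = A (x (n + 1)) + u n) {U : ℝ}
    (hu : ∀ n, ‖u n‖ ≤ U) (n : ℕ) : ‖x n‖ ≤ U / (1 - ‖A‖) := by
  obtain ⟨R, hR⟩ := hx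
  have hb : BddAbove (Set.range fun n => ‖x n‖) := ⟨R, by rintro _ ⟨n, rfl⟩; exact hR n⟩
  have hle : ∀ n, ‖x n‖ ≤ ⨆ n, ‖x n‖ := fun n => le_ciSup hb n
  have hs : (⨆ n, ‖x n‖) ≤ ‖A‖ * (⨆ n, ‖x n‖) + U := by
    refine ciSup_le fun n => ?_
    rw [step n]
    refine (norm_add_le _ _).trans (add_le_add ?_ (hu n))
    exact (A.le_opNorm _).trans (by gcongr; exact hle _)
  refine (hle n).trans ?_
  rw [le_div_iff₀ (by linarith)]
  linarith

theorem bounded_state_unique {A : F →L[ℝ] F} (hA : ‖A‖ < 1) {x y u : ℕ → F}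
    (hx : ∃ R : ℝ, ∀ n, ‖x n‖ ≤ R) (hy : ∃ R : ℝ, ∀ n, ‖y n‖ ≤ R)
    (hxs : ∀ n, x n = A (x (n + 1)) + u n) (hys : ∀ n, y n = A (y (n + 1)) + u n) : x = y := by
  obtain ⟨R, hR⟩ := hx
  obtain ⟨R', hR'⟩ := hy
  funext n
  have := norm_le_of_bounded_state (x := fun n => x n - y n) (u := fun _ => 0) (U := 0) hA
    ⟨R + R', fun n => (norm_sub_le _ _).trans (add_le_add (hR n) (hR' n))⟩
    (fun n => by rw [hxs n, hys n, map_sub]; abel) (by simp) n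
  simpa [sub_eq_zero] using this

/-- The solution is the Neumann series `∑ A^k u_{n+k}`, dominated by a geometric series. -/
theorem exists_bounded_state [CompleteSpace F] {A : F →L[ℝ] F} (hA : ‖A‖ < 1) {u : ℕ → F} {U : ℝ}
    (hu : ∀ n, ‖u n‖ ≤ U) :
    ∃ x : ℕ → F, (∃ R : ℝ, ∀ n, ‖x n‖ ≤ R) ∧ ∀ n, x n = A (x (n + 1)) + u n := by
  have hb : ∀ n k, ‖(A ^ k) (u (n + k))‖ ≤ ‖A‖ ^ k * U := fun n k =>
    (A.norm_pow_apply_le k _).trans (by gcongr; exact hu _)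
  have hg : Summable fun k : ℕ => ‖A‖ ^ k * U :=
    (summable_geometric_of_lt_one (norm_nonneg _) hA).mul_right U
  have hs : ∀ n, Summable fun k => (A ^ k) (u (n + k)) := fun n =>
    Summable.of_norm_bounded hg (hb n)
  refine ⟨fun n => ∑' k, (A ^ k) (u (n + k)), ⟨∑' k, ‖A‖ ^ k * U, fun n =>
    tsum_of_norm_bounded hg.hasSum (hb n)⟩, fun n => ?_⟩
  dsimp only
  rw [(hs n).tsum_eq_zero_add, A.map_tsum (hs (n + 1)), add_comm]
  congr 1
  refine tsum_congr fun k => ?_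
  rw [pow_succ', mul_apply_eq_comp]
  congr 3
  omega

theorem state_eq_sum_add (A : F →L[ℝ] F) {x u : ℕ → F} (step : ∀ n, x n = A (x (n + 1)) + u n)
    (n T : ℕ) :
    x n = ∑ k ∈ Finset.range T, (A ^ k) (u (n + k)) + (A ^ T) (x (n + T)) := by
  induction T with
  | zero => simp
  | succ T ih =>
    rw [ih, Finset.sum_range_succ, step (n + T), map_add, pow_succ, mul_apply_eq_comp]
    abel_nf

/-- Unrolling a state equation up to time `-T - 1`, when the inputs are replaced by `z'`, which may
differ from `z` at the last step only. -/
theorem state_one_eq_truncation_add (A : F →L[ℝ] F) (C : G →L[ℝ] F) (B : F) {x : ℕ → F} {z : ℕ → G}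
    (step : ∀ n, x n = A (x (n + 1)) + C (z n) + B) {T : ℕ} {z' : ℕ → G}
    (hz' : ∀ k < T, z' k = z (1 + k)) :
    x 1 = ∑ k ∈ Finset.range (T + 1), (A ^ k) B
      + ∑ k ∈ Finset.range (T + 1), (A ^ k) (C (z' k))
      + (A ^ T) (C (z (1 + T) - z' T) + A (x (1 + T + 1))) := by
  rw [state_eq_sum_add A (x := x) (u := fun n => C (z n) + B) (fun n => by rw [step n, add_assoc]) 1 T,
    Finset.sum_range_succ, Finset.sum_range_succ, step (1 + T)]
  have : ∑ k ∈ Finset.range T, (A ^ k) (C (z (1 + k)) + B)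
      = ∑ k ∈ Finset.range T, (A ^ k) B + ∑ k ∈ Finset.range T, (A ^ k) (C (z' k)) := by
    rw [← Finset.sum_add_distrib]
    refine Finset.sum_congr rfl fun k hk => ?_
    rw [hz' k (Finset.mem_range.1 hk), map_add, add_comm]
  rw [this]
  simp only [map_add, map_sub]
  abel

/-- The bound `V = (‖C‖ M + ‖B‖) / (1 - ‖A‖)` for bounded states satisfies `V = ‖A‖ V + ‖C‖ M +
‖B‖`, so it also controls one more step of the recursion driven by any input `e` of norm at most
`M`. -/
theorem norm_truncation_remainder_le {A : F →L[ℝ] F} (hA : ‖A‖ < 1) (C : G →L[ℝ] F) (B : F)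
    {x : ℕ → F} {z : ℕ → G} (hx : ∃ R : ℝ, ∀ n, ‖x n‖ ≤ R)
    (step : ∀ n, x n = A (x (n + 1)) + C (z n) + B) {M : ℝ} (hz : ∀ n, ‖z n‖ ≤ M) (T n : ℕ)
    {e : G} (he : ‖e‖ ≤ M) :
    ‖(A ^ T) (C e + A (x n))‖ ≤ ‖A‖ ^ T * ((‖C‖ * M + ‖B‖) / (1 - ‖A‖)) := by
  have hxn : ‖x n‖ ≤ (‖C‖ * M + ‖B‖) / (1 - ‖A‖) := by
    refine norm_le_of_bounded_state hA hx (fun n => by rw [step n, add_assoc]) (fun n => ?_) n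
    refine (norm_add_le _ _).trans (add_le_add_left ((C.le_opNorm _).trans ?_) _)
    gcongr
    exact hz n
  have h1 : 0 < 1 - ‖A‖ := by linarith
  refine (A.norm_pow_apply_le T _).trans ?_
  gcongr
  calc ‖C e + A (x n)‖ ≤ ‖C‖ * M + ‖A‖ * ((‖C‖ * M + ‖B‖) / (1 - ‖A‖)) := by
        refine (norm_add_le _ _).trans (add_le_add ((C.le_opNorm _).trans ?_)
          ((A.le_opNorm _).trans ?_))
        · gcongr
        · gcongr
    _ ≤ (‖C‖ * M + ‖B‖) / (1 - ‖A‖) := by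
        have : (‖C‖ * M + ‖B‖) / (1 - ‖A‖) - ‖A‖ * ((‖C‖ * M + ‖B‖) / (1 - ‖A‖))
            = ‖C‖ * M + ‖B‖ := by field_simp
        linarith [norm_nonneg B]

end LinearSystem

/-! ### Sums over blocks of length `d` -/

theorem Finset.sum_range_mul_div {F : Type*} [AddCommMonoid F] {d : ℕ} [NeZero d]
    (g : ℕ → Fin d → F) (n : ℕ) :
    ∑ i ∈ Finset.range (d * n), g (i / d) (Fin.ofNat d i) = ∑ k ∈ Finset.range n, ∑ j, g k j := by
  induction n with
  | zero => simp
  | succ n ih =>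
    have hd : 0 < d := Nat.pos_of_ne_zero (NeZero.ne d)
    rw [Nat.mul_succ, Finset.sum_range_add, ih, Finset.sum_range_succ]
    congr 1
    rw [← Fin.sum_univ_eq_sum_range (fun i => g ((d * n + i) / d) (Fin.ofNat d (d * n + i)))]
    refine Finset.sum_congr rfl fun j _ => ?_
    have h1 : (d * n + (j : ℕ)) / d = n := by
      rw [Nat.mul_add_div hd, Nat.div_eq_of_lt j.2, add_zero]
    have h2 : Fin.ofNat d (d * n + j) = j := by
      ext
      simp [Fin.ofNat, Nat.mod_eq_of_lt j.2]
    rw [h1, h2]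

/-- As `d` need not divide `N`, the indicator drops the indices of the blocks that lie beyond `N`.
-/
theorem Fin.sum_univ_div {F : Type*} [AddCommMonoid F] {d N T : ℕ} [NeZero d]
    (hN : N ≤ d * T) (g : ℕ → Fin d → F) :
    ∑ i : Fin N, g ((i : ℕ) / d) (Fin.ofNat d i)
      = ∑ k ∈ Finset.range T, ∑ j : Fin d, if d * k + j < N then g k j else 0 := by
  rw [← Finset.sum_range_mul_div (fun k j => if d * k + (j : ℕ) < N then g k j else 0) T,
    Fin.sum_univ_eq_sum_range (fun i => g (i / d) (Fin.ofNat d i)) N]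
  have : ∀ i, d * (i / d) + ((Fin.ofNat d i : Fin d) : ℕ) = i := fun i => by
    simp [Fin.ofNat, Nat.div_add_mod]
  simp_rw [this]
  rw [← Finset.sum_filter]
  refine Finset.sum_congr ?_ fun _ _ => rfl
  ext i
  simp only [Finset.mem_range, Finset.mem_filter]
  omega

section Horizon

variable {N d : ℕ}

theorem le_mul_horizon [NeZero d] : N ≤ d * horizon N d := by
  have hd : (0 : ℝ) < d := by exact_mod_cast Nat.pos_of_ne_zero (NeZero.ne d)
  have := Nat.le_ceil ((N : ℝ) / d)
  rw [div_le_iff₀ hd] at this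
  have h2 : (N : ℝ) ≤ ((d * horizon N d : ℕ) : ℝ) := by
    push_cast
    rw [mul_comm]
    exact this
  exact_mod_cast h2

theorem mul_pred_horizon_lt [NeZero d] [NeZero N] : d * (horizon N d - 1) < N := by
  have hd : (0 : ℝ) < d := by exact_mod_cast Nat.pos_of_ne_zero (NeZero.ne d)
  have hN : (0 : ℝ) < N := by exact_mod_cast Nat.pos_of_ne_zero (NeZero.ne N)
  have h : horizon N d - 1 < horizon N d := by
    have : 0 < horizon N d := Nat.ceil_pos.2 (by positivity)
    omega
  have := Nat.lt_ceil.1 h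
  rw [lt_div_iff₀ hd] at this
  have h2 : ((d * (horizon N d - 1) : ℕ) : ℝ) < N := by
    rw [Nat.cast_mul, mul_comm]
    exact this
  exact_mod_cast h2

theorem horizon_pos [NeZero d] [NeZero N] : 0 < horizon N d := by
  have hd : (0 : ℝ) < d := by exact_mod_cast Nat.pos_of_ne_zero (NeZero.ne d)
  have hN : (0 : ℝ) < N := by exact_mod_cast Nat.pos_of_ne_zero (NeZero.ne N)
  exact Nat.ceil_pos.2 (by positivity)

end Horizon

/-! ### The pairing of `ℓ^p` and `ℓ^q` -/

section Pairing

variable {p q : ℝ≥0∞}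

theorem summable_seqDot (hpq : p.toReal.HolderConjugate q.toReal) (a : SeqSpace p)
    (x : SeqSpace q) : Summable fun i => a i * x i := by
  refine Summable.of_norm ?_
  simpa only [norm_mul] using (lp.tsum_mul_le_mul_norm hpq a x).1

theorem abs_seqDot_le (hpq : p.toReal.HolderConjugate q.toReal) (a : SeqSpace p)
    (x : SeqSpace q) : |seqDot a x| ≤ ‖a‖ * ‖x‖ := by
  obtain ⟨hs, hle⟩ := lp.tsum_mul_le_mul_norm hpq a x
  simp only [← norm_mul] at hs hle
  exact (norm_tsum_le_tsum_norm hs).trans hle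

/-- The pairing `seqDot` is a continuous bilinear map of norm at most one. -/
theorem exists_seqDot_clm [Fact (1 ≤ p)] [Fact (1 ≤ q)]
    (hpq : p.toReal.HolderConjugate q.toReal) :
    ∃ Φ : SeqSpace p →L[ℝ] SeqSpace q →L[ℝ] ℝ,
      (∀ a x, Φ a x = seqDot a x) ∧ ∀ a, ‖Φ a‖ ≤ ‖a‖ := by
  have key : ∀ (a : SeqSpace p) (x : SeqSpace q), Summable fun i => a i * x i :=
    summable_seqDot hpq
  let φ : SeqSpace p →ₗ[ℝ] SeqSpace q →ₗ[ℝ] ℝ := LinearMap.mk₂ ℝ seqDot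
    (fun a b x => by
      simp only [seqDot, lp.coeFn_add, Pi.add_apply, add_mul]
      exact (key a x).tsum_add (key b x))
    (fun c a x => by
      simp only [seqDot, lp.coeFn_smul, Pi.smul_apply, smul_eq_mul, mul_assoc, tsum_mul_left])
    (fun a x y => by
      simp only [seqDot, lp.coeFn_add, Pi.add_apply, mul_add]
      exact (key a x).tsum_add (key a y))
    (fun c a x => by
      simp only [seqDot, lp.coeFn_smul, Pi.smul_apply, smul_eq_mul, mul_left_comm _ c,
        tsum_mul_left])
  refine ⟨φ.mkContinuous₂ 1 fun a x => ?_, fun a x => rfl, fun a => ?_⟩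
  · rw [one_mul]
    exact abs_seqDot_le hpq a x
  · exact ContinuousLinearMap.opNorm_le_bound _ (norm_nonneg _) fun x => abs_seqDot_le hpq a x

end Pairing

/-! ### Truncated inputs -/

section Truncation

variable {d : ℕ}

/-- The vector `w` of values on the basis represents `ψ`, so `‖w‖² = ψ w ≤ ‖ψ‖ ‖w‖`. -/
theorem sum_sq_apply_single_le (ψ : Vec d →L[ℝ] ℝ) :
    ∑ j, ψ (EuclideanSpace.single j 1) ^ 2 ≤ ‖ψ‖ ^ 2 := by
  set s := ∑ j, ψ (EuclideanSpace.single j 1) ^ 2 with hs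
  let w : Vec d := ∑ j, ψ (EuclideanSpace.single j 1) • EuclideanSpace.single j 1
  have hw : ψ w = s := by
    simp only [w, map_sum, map_smul, smul_eq_mul, hs, sq]
  have hwi : ∀ j, w j = ψ (EuclideanSpace.single j 1) := fun j => by
    simp [w, Finset.sum_apply, Pi.single_apply]
  have hn : ‖w‖ ^ 2 = s := by
    rw [EuclideanSpace.norm_sq_eq]
    simp [hwi, hs]
  have hs0 : 0 ≤ s := Finset.sum_nonneg fun _ _ => sq_nonneg _
  have h1 : s ≤ ‖ψ‖ * ‖w‖ := by
    rw [← hw]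
    exact (le_abs_self _).trans (ψ.le_opNorm w)
  rcases eq_or_lt_of_le (norm_nonneg w) with h | h
  · rw [← hn, ← h]
    simp
  · have : ‖w‖ ≤ ‖ψ‖ := by
      rw [← hn, sq] at h1
      exact le_of_mul_le_mul_right h1 h
    rw [← hn]
    gcongr

/-- The entries of block `k` are values of the functional `φ ∘ A^k ∘ C` on basis vectors, so each
block is estimated by an operator norm without a factor `d`. -/
theorem sum_sq_apply_pow_apply_le {F : Type*} [NormedAddCommGroup F] [NormedSpace ℝ F] [NeZero d]
    {N T : ℕ} (hN : N ≤ d * T) (φ : F →L[ℝ] ℝ) (A : F →L[ℝ] F) (C : Vec d →L[ℝ] F) :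
    ∑ i : Fin N, φ ((A ^ ((i : ℕ) / d)) (C (EuclideanSpace.single (Fin.ofNat d i) 1))) ^ 2
      ≤ (‖φ‖ * ‖C‖) ^ 2 * ∑ k ∈ Finset.range T, (‖A‖ ^ k) ^ 2 := by
  rw [Fin.sum_univ_div hN fun k j => φ ((A ^ k) (C (EuclideanSpace.single j 1))) ^ 2,
    Finset.mul_sum]
  refine Finset.sum_le_sum fun k _ => ?_
  calc _ ≤ ∑ j, φ ((A ^ k) (C (EuclideanSpace.single j 1))) ^ 2 := by
        refine Finset.sum_le_sum fun j _ => ?_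
        split_ifs
        · exact le_rfl
        · positivity
    _ ≤ ‖φ ∘L (A ^ k) ∘L C‖ ^ 2 := sum_sq_apply_single_le (φ ∘L (A ^ k) ∘L C)
    _ ≤ (‖φ‖ * ‖C‖) ^ 2 * (‖A‖ ^ k) ^ 2 := by
        rw [← mul_pow]
        gcongr
        refine ContinuousLinearMap.opNorm_le_bound _ (by positivity) fun x => ?_
        calc ‖φ ((A ^ k) (C x))‖ ≤ ‖φ‖ * (‖A‖ ^ k * (‖C‖ * ‖x‖)) := by
              refine (φ.le_opNorm _).trans ?_
              gcongr
              refine (A.norm_pow_apply_le k _).trans ?_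
              gcongr
              exact C.le_opNorm x
          _ = _ := by ring

/-- The inputs `z_{-1}, z_{-2}, …`, of which only the first `N` scalar entries are kept. -/
noncomputable def truncatedInput (N : ℕ) (z : InputSeq d) (k : ℕ) : Vec d :=
  WithLp.toLp 2 fun j => if d * k + j < N then z (1 + k) j else 0

theorem truncatedInput_eq {N T : ℕ} (hT : d * T < N) (z : InputSeq d) {k : ℕ} (hk : k < T) :
    truncatedInput N z k = z (1 + k) := by
  ext j
  have : d * k + j < N := by
    have h1 : d * (k + 1) ≤ d * T := Nat.mul_le_mul_left d hk
    have := j.2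
    rw [Nat.mul_succ] at h1
    omega
  simp [truncatedInput, this]

/-- Each coordinate of the difference is either zero or that of `z (1 + k)`. The discarded part is
therefore no larger than a genuine input and can be put into the remainder. -/
theorem norm_sub_truncatedInput_le (N : ℕ) (z : InputSeq d) (k : ℕ) :
    ‖z (1 + k) - truncatedInput N z k‖ ≤ ‖z (1 + k)‖ := by
  rw [EuclideanSpace.norm_eq, EuclideanSpace.norm_eq]
  refine Real.sqrt_le_sqrt (Finset.sum_le_sum fun j _ => ?_)
  simp only [truncatedInput, PiLp.sub_apply]
  split_ifs
  · simp [sq_nonneg]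
  · simp

theorem sum_pow_apply_truncatedInput {F : Type*} [NormedAddCommGroup F] [NormedSpace ℝ F]
    [NeZero d] {N T : ℕ} (hN : N ≤ d * T) (A : F →L[ℝ] F) (C : Vec d →L[ℝ] F) (z : InputSeq d) :
    ∑ k ∈ Finset.range T, (A ^ k) (C (truncatedInput N z k))
      = ∑ i : Fin N, z (1 + (i : ℕ) / d) (Fin.ofNat d i) •
          (A ^ ((i : ℕ) / d)) (C (EuclideanSpace.single (Fin.ofNat d i) 1)) := by
  rw [Fin.sum_univ_div hN
    fun k j => z (1 + k) j • (A ^ k) (C (EuclideanSpace.single j 1))]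
  refine Finset.sum_congr rfl fun k _ => ?_
  have hsum : ∀ w : Vec d, w = ∑ j, w j • EuclideanSpace.single j (1 : ℝ) := fun w => by
    ext l
    simp [Finset.sum_apply, Pi.single_apply]
  rw [hsum (truncatedInput N z k), map_sum, map_sum]
  refine Finset.sum_congr rfl fun j _ => ?_
  rw [map_smul, map_smul]
  simp only [truncatedInput]
  split_ifs <;> simp

end Truncation

/-! ### The echo state network -/

theorem Matrix.norm_toEuclideanLin_apply_le {m n : ℕ} (Q : Matrix (Fin m) (Fin n) ℝ) (x : Vec n) :
    ‖Q.toEuclideanLin x‖ ≤ ‖Q‖ * ‖x‖ :=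
  (LinearMap.toContinuousLinearMap Q.toEuclideanLin).le_opNorm x

namespace ESN

variable {N d : ℕ} (E : ESN N d)

/-- The connectivity matrix as a bounded operator. -/
noncomputable def clmA : Vec N →L[ℝ] Vec N := Matrix.toEuclideanCLM (n := Fin N) (𝕜 := ℝ) E.A

/-- The input matrix as a bounded operator. -/
noncomputable def clmC : Vec d →L[ℝ] Vec N := LinearMap.toContinuousLinearMap E.C.toEuclideanLin

theorem norm_clmA : ‖E.clmA‖ = ‖E.A‖ := Matrix.l2_opNorm_toEuclideanCLM E.A

theorem norm_clmC : ‖E.clmC‖ = ‖E.C‖ := rfl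

theorem clmA_pow_apply (k : ℕ) (x : Vec N) : (E.clmA ^ k) x = (E.A ^ k).toEuclideanLin x := by
  rw [clmA, ← map_pow]
  rfl

theorem isState_id_iff {z : InputSeq d} {x : ℕ → Vec N} :
    E.IsState id z x ↔ (∃ R : ℝ, ∀ n, ‖x n‖ ≤ R) ∧
      ∀ n, x n = E.clmA (x (n + 1)) + E.clmC (z n) + E.B := by
  refine ⟨fun h => ⟨h.bounded, fun n => ?_⟩, fun h => ⟨h.1, fun n i => ?_⟩⟩
  · ext i
    exact h.step n i
  · rw [h.2 n]
    rfl

theorem existsUnique_isState_id (hE : ‖E.A‖ < 1) {z : InputSeq d} {M : ℝ}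
    (hz : ∀ n, ‖z n‖ ≤ M) : ∃! x : ℕ → Vec N, E.IsState id z x := by
  have hE' : ‖E.clmA‖ < 1 := by rwa [norm_clmA]
  have hu : ∀ n, ‖E.clmC (z n) + E.B‖ ≤ ‖E.clmC‖ * M + ‖E.B‖ := fun n =>
    (norm_add_le _ _).trans (by
      gcongr
      exact (E.clmC.le_opNorm _).trans (by gcongr; exact hz n))
  obtain ⟨x, hb, hs⟩ := exists_bounded_state hE' hu
  refine ⟨x, E.isState_id_iff.2 ⟨hb, fun n => by rw [hs n, add_assoc]⟩, fun y hy => ?_⟩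
  obtain ⟨hyb, hys⟩ := E.isState_id_iff.1 hy
  exact bounded_state_unique hE' hyb hb (fun n => by rw [hys n, add_assoc]) hs

theorem K_toEuclideanLin_apply [NeZero d] (ζ : Fin N → ℝ) :
    E.K.toEuclideanLin (WithLp.toLp 2 ζ)
      = ∑ i : Fin N, ζ i •
          (E.clmA ^ ((i : ℕ) / d)) (E.clmC (EuclideanSpace.single (Fin.ofNat d i) 1)) := by
  ext r
  have h : ∀ (k : ℕ) (j : Fin d),
      ((E.clmA ^ k) (E.clmC (EuclideanSpace.single j 1))) r = (E.A ^ k * E.C) r j := by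
    intro k j
    rw [clmA_pow_apply]
    change Matrix.mulVec (E.A ^ k) (Matrix.mulVec E.C (Pi.single j 1)) r = _
    rw [Matrix.mulVec_mulVec, Matrix.mulVec_single_one]
    rfl
  have h' : (E.K.toEuclideanLin (WithLp.toLp 2 ζ)) r
      = ∑ i : Fin N, (E.A ^ ((i : ℕ) / d) * E.C) r (Fin.ofNat d i) * ζ i := rfl
  rw [h', WithLp.ofLp_sum, Finset.sum_apply]
  refine Finset.sum_congr rfl fun i _ => ?_
  rw [WithLp.ofLp_smul, Pi.smul_apply, h, smul_eq_mul, mul_comm]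

/-- Moving `K` to the other side of the inner product leaves `K^⊤ K^{-⊤} Λ = Λ`, which is diagonal.
-/
theorem inner_KinvTΛ_K [NeZero d] (hK : IsUnit E.K) (lam : ℝ) (l ζ : Fin N → ℝ) :
    inner ℝ ((E.KinvTΛ lam).toEuclideanLin (WithLp.toLp 2 l))
        (E.K.toEuclideanLin (WithLp.toLp 2 ζ))
      = ∑ i : Fin N, lam ^ ((i : ℕ) / d) * l i * ζ i := by
  have hdet : IsUnit E.K.det := (Matrix.isUnit_iff_isUnit_det _).1 hK
  have h : E.K.transpose * E.KinvTΛ lam = scalingMatrix N d lam := by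
    rw [KinvTΛ, ← Matrix.mul_assoc, ← Matrix.transpose_mul, Matrix.nonsing_inv_mul _ hdet,
      Matrix.transpose_one, Matrix.one_mul]
  rw [EuclideanSpace.inner_eq_star_dotProduct, star_trivial]
  simp only [Matrix.toLpLin_apply]
  rw [dotProduct_comm, Matrix.dotProduct_mulVec, ← Matrix.mulVec_transpose, Matrix.mulVec_mulVec, h]
  simp [scalingMatrix, dotProduct, Matrix.mulVec_diagonal]

/-- Test the pairing on the first basis vector: `Λ` has entry `λ^0 = 1` there, and the first column
of `K` is a column of `C^E`. This is what gives `Γ ≥ 1 / (1 - ‖A^E‖)`. -/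
theorem one_le_norm_KinvTΛ_mul_norm_C [NeZero d] [NeZero N] (hK : IsUnit E.K) (lam : ℝ) :
    1 ≤ ‖E.KinvTΛ lam‖ * ‖E.C‖ := by
  have h := E.inner_KinvTΛ_K hK lam (Pi.single 0 1) (Pi.single 0 1)
  have h1 : ∑ i : Fin N, lam ^ ((i : ℕ) / d) * (Pi.single 0 1 : Fin N → ℝ) i
      * (Pi.single 0 1 : Fin N → ℝ) i = 1 := by
    rw [Finset.sum_eq_single (0 : Fin N)]
    · simp
    · intro b _ hb
      simp [hb]
    · simp
  have h2 : ‖E.K.toEuclideanLin (WithLp.toLp 2 (Pi.single 0 1))‖ ≤ ‖E.C‖ := by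
    rw [K_toEuclideanLin_apply, Finset.sum_eq_single (0 : Fin N)]
    · simp only [Pi.single_eq_same, one_smul, Fin.coe_ofNat_eq_mod, Nat.zero_mod, Nat.zero_div,
        pow_zero, one_apply_eq_self]
      refine (E.clmC.le_opNorm _).trans ?_
      simp [norm_clmC]
    · intro b _ hb
      simp [hb]
    · simp
  have h3 : ‖(E.KinvTΛ lam).toEuclideanLin (WithLp.toLp 2 (Pi.single 0 1))‖ ≤ ‖E.KinvTΛ lam‖ := by
    refine (Matrix.norm_toEuclideanLin_apply_le _ _).trans (le_of_eq ?_)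
    have h4 : ‖(WithLp.toLp 2 (Pi.single 0 1) : Vec N)‖ = 1 := by
      simp
    rw [h4, mul_one]
  rw [h1] at h
  rw [← h]
  exact (real_inner_le_norm _ _).trans (by gcongr)

end ESN

/-! ### The error of the transfer to the echo state network, parameter by parameter -/

section Transfer

variable {p q : ℝ≥0∞} [Fact (1 ≤ p)] [Fact (1 ≤ q)] {N d : ℕ}

theorem IsSeqState.step_id {A : SeqSpace q →L[ℝ] SeqSpace q} {B : SeqSpace q}
    {C : Vec d →L[ℝ] SeqSpace q} {z : InputSeq d} {x : ℕ → SeqSpace q}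
    (h : IsSeqState id A.toLinearMap B C.toLinearMap z x) (n : ℕ) :
    x n = A (x (n + 1)) + C (z n) + B := by
  ext i
  exact h.step n i

variable [NeZero d]

/-- The readout vector `v(a) = K^{-⊤} Λ π L̄(a)`. -/
noncomputable def transferVec (E : ESN N d) (A : SeqSpace q →L[ℝ] SeqSpace q)
    (C : Vec d →L[ℝ] SeqSpace q) (lam : ℝ) (a : SeqSpace p) : Vec N :=
  (E.KinvTΛ lam).toEuclideanLin (WithLp.toLp 2 fun i : Fin N => Lbar A C lam a i)

theorem continuous_seqDot_left (hpq : p.toReal.HolderConjugate q.toReal) (x : SeqSpace q) :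
    Continuous fun a : SeqSpace p => seqDot a x := by
  obtain ⟨Φ, hΦ, -⟩ := exists_seqDot_clm hpq
  simp only [← hΦ]
  fun_prop

theorem continuous_transferVec (hpq : p.toReal.HolderConjugate q.toReal) (E : ESN N d)
    (A : SeqSpace q →L[ℝ] SeqSpace q) (C : Vec d →L[ℝ] SeqSpace q) (lam : ℝ) :
    Continuous (transferVec E A C lam : SeqSpace p → Vec N) := by
  refine (LinearMap.continuous_of_finiteDimensional _).comp
    ((PiLp.continuous_toLp 2 _).comp (continuous_pi fun i => ?_))
  exact continuous_seqDot_left hpq _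

theorem measurable_psi (hpq : p.toReal.HolderConjugate q.toReal) (E : ESN N d)
    (A : SeqSpace q →L[ℝ] SeqSpace q) (B : SeqSpace q) (C : Vec d →L[ℝ] SeqSpace q) (lam : ℝ) :
    Measurable (psi E A B C lam : ParamSpace p d → FinParamSpace N d) := by
  have ha : Measurable fun θ : ParamSpace p d => θ.2.1 := by fun_prop
  have hv := (continuous_transferVec (p := p) hpq E A C lam).measurable.comp ha
  have hs := (continuous_seqDot_left (p := p) hpq (∑' k : ℕ, (A ^ k) B)).measurable.comp ha
  refine measurable_fst.prodMk (hv.prodMk (Measurable.prodMk (by fun_prop) ?_))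
  exact ((hv.inner_const (c := _)).neg.add hs).add (by fun_prop)

/-- The factor `λ^k` of `Λ` cancels `λ^{-k}` in `L̄(a)`: on the first `N` scalar inputs the network
reproduces the target without error. -/
theorem inner_transferVec_K (hpq : p.toReal.HolderConjugate q.toReal) {E : ESN N d}
    (hK : IsUnit E.K) (A : SeqSpace q →L[ℝ] SeqSpace q) (C : Vec d →L[ℝ] SeqSpace q) {lam : ℝ}
    (hlam : lam ≠ 0) (a : SeqSpace p) (ζ : Fin N → ℝ) :
    inner ℝ (transferVec E A C lam a) (E.K.toEuclideanLin (WithLp.toLp 2 ζ))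
      = seqDot a (∑ i : Fin N, ζ i •
          (A ^ ((i : ℕ) / d)) (C (EuclideanSpace.single (Fin.ofNat d i) 1))) := by
  obtain ⟨Φ, hΦ, -⟩ := exists_seqDot_clm hpq
  rw [transferVec, E.inner_KinvTΛ_K hK, ← hΦ, map_sum]
  refine Finset.sum_congr rfl fun i _ => ?_
  rw [Lbar, ← hΦ, smul_pow, smul_apply, map_smul, map_smul, smul_eq_mul,
    smul_eq_mul, ← mul_assoc, ← mul_pow, mul_inv_cancel₀ hlam, one_pow, one_mul, mul_comm]

theorem norm_transferVec_le (hpq : p.toReal.HolderConjugate q.toReal) (E : ESN N d)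
    (A : SeqSpace q →L[ℝ] SeqSpace q) (C : Vec d →L[ℝ] SeqSpace q) (lam : ℝ) (a : SeqSpace p)
    {T : ℕ} (hT : N ≤ d * T) :
    ‖transferVec E A C lam a‖
      ≤ ‖E.KinvTΛ lam‖ * (‖a‖ * ‖C‖ * √(∑ k ∈ Finset.range T, (‖lam⁻¹ • A‖ ^ k) ^ 2)) := by
  obtain ⟨Φ, hΦ, hΦn⟩ := exists_seqDot_clm (p := p) (q := q) hpq
  refine (Matrix.norm_toEuclideanLin_apply_le _ _).trans ?_
  gcongr
  rw [EuclideanSpace.norm_eq]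
  simp only [Real.norm_eq_abs, sq_abs, Lbar, ← hΦ]
  refine (Real.sqrt_le_sqrt (sum_sq_apply_pow_apply_le hT (Φ a) (lam⁻¹ • A) C)).trans ?_
  rw [Real.sqrt_mul (by positivity), Real.sqrt_sq (by positivity)]
  gcongr
  exact hΦn a

/-- Both states are unrolled along the same truncated input. The input sums agree after pairing, the
constants are cancelled by the bias in `psi`, and only the two remainders survive. -/
theorem abs_psi_arg_sub_le (hpq : p.toReal.HolderConjugate q.toReal) [NeZero N] {E : ESN N d}
    (hE : ‖E.A‖ < 1) (hK : IsUnit E.K) {A : SeqSpace q →L[ℝ] SeqSpace q} (hA : ‖A‖ < 1)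
    {B : SeqSpace q} {C : Vec d →L[ℝ] SeqSpace q} {lam : ℝ} (hlam : lam ≠ 0) {z : InputSeq d}
    {M : ℝ} (hz : ∀ n, ‖z n‖ ≤ M) {x : ℕ → SeqSpace q}
    (hx : IsSeqState id A.toLinearMap B C.toLinearMap z x) {y : ℕ → Vec N}
    (hy : E.IsState id z y) (θ : ParamSpace p d) :
    |inner ℝ (psi E A B C lam θ).2.1 (y 1) + (psi E A B C lam θ).2.2.2
        - (seqDot θ.2.1 (x 1) + θ.2.2.2)|
      ≤ ‖θ.2.1‖ * (‖A‖ ^ (horizon N d - 1) * (‖C‖ * M / (1 - ‖A‖)))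
        + ‖transferVec E A C lam θ.2.1‖
          * (‖E.A‖ ^ (horizon N d - 1) * ((‖E.C‖ * M + ‖E.B‖) / (1 - ‖E.A‖))) := by
  obtain ⟨Φ, hΦ, hΦn⟩ := exists_seqDot_clm (p := p) (q := q) hpq
  -- From here on `T` is the horizon minus one: blocks `0, …, T - 1` are complete, and block `T` is
  -- possibly cut. Hence the exponent `T` in the remainders.
  obtain ⟨T, hT⟩ : ∃ T, horizon N d = T + 1 := ⟨horizon N d - 1, by
    have := horizon_pos (N := N) (d := d); omega⟩
  have hle : N ≤ d * (T + 1) := hT ▸ le_mul_horizon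
  have hlt : d * T < N := by
    have := mul_pred_horizon_lt (N := N) (d := d)
    rwa [hT] at this
  rw [hT, Nat.add_sub_cancel]
  obtain ⟨hyb, hys⟩ := E.isState_id_iff.1 hy
  set a := θ.2.1 with ha
  set v := transferVec E A C lam a with hv
  -- the states, without the contribution of the constant input `B`
  set b := ∑' k : ℕ, (A ^ k) B with hb
  have hsum : Summable fun k : ℕ => (A ^ k) B :=
    Summable.of_norm_bounded ((summable_geometric_of_lt_one (norm_nonneg _) hA).mul_right ‖B‖)
      fun k => A.norm_pow_apply_le k B
  have hbeq : b = A b + B := by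
    rw [hb, A.map_tsum hsum]
    conv_lhs => rw [hsum.tsum_eq_zero_add, add_comm]
    simp only [pow_succ', mul_apply_eq_comp, pow_zero, one_apply_eq_self]
  obtain ⟨R, hR⟩ := hx.bounded
  have hxb : ∃ R : ℝ, ∀ n, ‖x n - b‖ ≤ R :=
    ⟨R + ‖b‖, fun n => (norm_sub_le _ _).trans (by gcongr; exact hR n)⟩
  have hxs : ∀ n, x n - b = A (x (n + 1) - b) + C (z n) + 0 := fun n => by
    conv_lhs => rw [hx.step_id n, hbeq]
    rw [map_sub]
    abel
  have hcut : ∀ k < T, truncatedInput N z k = z (1 + k) := fun k hk => truncatedInput_eq hlt z hk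
  have he : ‖z (1 + T) - truncatedInput N z T‖ ≤ M :=
    (norm_sub_truncatedInput_le N z T).trans (hz _)
  have ex := state_one_eq_truncation_add A C 0 (x := fun n => x n - b) hxs hcut
  have rx := norm_truncation_remainder_le (x := fun n => x n - b) hA C 0 hxb hxs hz T
    (1 + T + 1) he
  have ey := state_one_eq_truncation_add E.clmA E.clmC E.B hys hcut
  have ry := norm_truncation_remainder_le (E.norm_clmA.trans_lt hE) E.clmC E.B hyb hys hz T
    (1 + T + 1) he
  rw [sum_pow_apply_truncatedInput hle] at ex ey
  rw [← E.K_toEuclideanLin_apply fun i : Fin N => z (1 + (i : ℕ) / d) (Fin.ofNat d i)] at ey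
  simp only [E.norm_clmA, E.norm_clmC, norm_zero, add_zero, map_zero, Finset.sum_const_zero,
    zero_add] at ex rx ry
  set rX := (A ^ T) (C (z (1 + T) - truncatedInput N z T) + A (x (1 + T + 1) - b))
  set rY := (E.clmA ^ T) (E.clmC (z (1 + T) - truncatedInput N z T) + E.clmA (y (1 + T + 1)))
  have hpair := inner_transferVec_K hpq hK A C hlam a
    fun i : Fin N => z (1 + (i : ℕ) / d) (Fin.ofNat d i)
  have hB : ∑ k ∈ Finset.range (T + 1), (E.A ^ k).toEuclideanLin E.B
      = ∑ k ∈ Finset.range (T + 1), (E.clmA ^ k) E.B :=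
    Finset.sum_congr rfl fun k _ => (E.clmA_pow_apply k E.B).symm
  -- The constant of the network is summed over exactly `T + 1` powers, as in the bias, while that
  -- of the target was removed completely by subtracting the fixed point `b`.
  have hval : inner ℝ (psi E A B C lam θ).2.1 (y 1) + (psi E A B C lam θ).2.2.2
      - (seqDot a (x 1) + θ.2.2.2) = inner ℝ v rY - Φ a rX := by
    change inner ℝ v (y 1) + (-inner ℝ v (∑ k ∈ Finset.range (horizon N d),
      (E.A ^ k).toEuclideanLin E.B) + seqDot a b + θ.2.2.2) - (seqDot a (x 1) + θ.2.2.2) = _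
    have hx1 : seqDot a (x 1) = Φ a (x 1 - b) + seqDot a b := by
      rw [map_sub, hΦ, hΦ]
      ring
    rw [hx1, ex, hT, hB, ey, inner_add_right, inner_add_right, hpair, map_add, hΦ]
    ring
  rw [hval]
  refine (abs_sub _ _).trans ?_
  rw [add_comm]
  refine add_le_add ?_ ?_
  · refine ((Φ a).le_opNorm rX).trans ?_
    gcongr
    exact hΦn a
  · refine (abs_real_inner_le_norm _ _).trans ?_
    gcongr

end Transfer

/-! ### Importance sampling -/

section ImportanceSampling

variable {X Ω : Type*} [MeasurableSpace X] [MeasurableSpace Ω]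

/-- A density of mean one cannot stay below one. Consequently the sampling term of the rate is at
least `N^{-1/2}`. -/
theorem one_le_essSup_rnDeriv (κ ν : Measure X) [IsProbabilityMeasure κ] [IsProbabilityMeasure ν]
    (hac : κ ≪ ν) : 1 ≤ essSup (κ.rnDeriv ν) ν := by
  calc (1 : ℝ≥0∞) = ∫⁻ x, κ.rnDeriv ν x ∂ν := by
        rw [Measure.lintegral_rnDeriv hac, measure_univ]
    _ ≤ ∫⁻ _, essSup (κ.rnDeriv ν) ν ∂ν := lintegral_mono_ae (ENNReal.ae_le_essSup _)
    _ = _ := by simp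

theorem sq_integral_le_integral_sq {μ : Measure X} [IsProbabilityMeasure μ] {h : X → ℝ}
    (hh : MemLp h 2 μ) : (∫ x, h x ∂μ) ^ 2 ≤ ∫ x, h x ^ 2 ∂μ := by
  have h1 := variance_eq_sub hh
  have h2 := variance_nonneg h μ
  simp only [Pi.pow_apply] at h1
  linarith

/-- One of the two factors of the squared density is bounded by its essential supremum; the other
changes the measure from `ν` to `κ`. -/
theorem memLp_two_rnDeriv_mul {κ ν : Measure X} [IsFiniteMeasure κ] [IsFiniteMeasure ν]
    (hac : κ ≪ ν) (hb : essSup (κ.rnDeriv ν) ν < ∞) {h : X → ℝ} (hm : Measurable h)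
    (hh : MemLp h 2 κ) :
    MemLp (fun x => (κ.rnDeriv ν x).toReal * h x) 2 ν ∧
      ∫ x, ((κ.rnDeriv ν x).toReal * h x) ^ 2 ∂ν
        ≤ (essSup (κ.rnDeriv ν) ν).toReal * ∫ x, h x ^ 2 ∂κ := by
  set g := essSup (κ.rnDeriv ν) ν
  have hmeas : Measurable fun x => (κ.rnDeriv ν x).toReal * h x :=
    (Measure.measurable_rnDeriv κ ν).ennreal_toReal.mul hm
  have hint : Integrable (fun x => g.toReal * ((κ.rnDeriv ν x).toReal • h x ^ 2)) ν :=
    ((integrable_rnDeriv_smul_iff hac).2 hh.integrable_sq).const_mul _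
  have hle : ∀ᵐ x ∂ν, ((κ.rnDeriv ν x).toReal * h x) ^ 2
      ≤ g.toReal * ((κ.rnDeriv ν x).toReal • h x ^ 2) := by
    filter_upwards [ENNReal.ae_le_essSup (μ := ν) (κ.rnDeriv ν)] with x hx
    have h1 : (κ.rnDeriv ν x).toReal ≤ g.toReal := ENNReal.toReal_mono hb.ne hx
    have h2 : 0 ≤ (κ.rnDeriv ν x).toReal := ENNReal.toReal_nonneg
    calc ((κ.rnDeriv ν x).toReal * h x) ^ 2
        = (κ.rnDeriv ν x).toReal * ((κ.rnDeriv ν x).toReal * h x ^ 2) := by ring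
      _ ≤ g.toReal * ((κ.rnDeriv ν x).toReal * h x ^ 2) := by gcongr
  have hint2 : Integrable (fun x => ((κ.rnDeriv ν x).toReal * h x) ^ 2) ν := by
    refine hint.mono' (hmeas.pow_const 2).aestronglyMeasurable ?_
    filter_upwards [hle] with x hx
    rwa [Real.norm_of_nonneg (sq_nonneg _)]
  refine ⟨(memLp_two_iff_integrable_sq hmeas.aestronglyMeasurable).2 hint2, ?_⟩
  refine (integral_mono_ae hint2 hint hle).trans (le_of_eq ?_)
  rw [integral_const_mul, integral_rnDeriv_smul hac]

/-- The mean square error of the importance sampling estimator of `∫ h dκ`, based on `N`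
independent samples from `ν`, as an estimator of a number `c`. -/
theorem importance_sampling_mse_le {κ ν : Measure X} [IsFiniteMeasure κ] [IsFiniteMeasure ν]
    (hac : κ ≪ ν) (hb : essSup (κ.rnDeriv ν) ν < ∞) {h : X → ℝ} (hm : Measurable h)
    (hh : MemLp h 2 κ) {N : ℕ} [NeZero N] {P : Measure Ω} [IsProbabilityMeasure P]
    {θ : Fin N → Ω → X} (hθ : ∀ i, Measurable (θ i)) (hindep : iIndepFun θ P)
    (hlaw : ∀ i, P.map (θ i) = ν) (c : ℝ) :
    Integrable (fun ω =>
        |c - ∑ i, (N : ℝ)⁻¹ * ((κ.rnDeriv ν (θ i ω)).toReal * h (θ i ω))| ^ 2) P ∧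
      ∫ ω, |c - ∑ i, (N : ℝ)⁻¹ * ((κ.rnDeriv ν (θ i ω)).toReal * h (θ i ω))| ^ 2 ∂P
        ≤ (c - ∫ x, h x ∂κ) ^ 2
          + (essSup (κ.rnDeriv ν) ν).toReal / N * ∫ x, h x ^ 2 ∂κ := by
  obtain ⟨hF, hFle⟩ := memLp_two_rnDeriv_mul hac hb hm hh
  have hN : (N : ℝ) ≠ 0 := by exact_mod_cast NeZero.ne N
  set F : X → ℝ := fun x => (κ.rnDeriv ν x).toReal * h x with hFdef
  have hFm : Measurable F := (Measure.measurable_rnDeriv κ ν).ennreal_toReal.mul hm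
  have hY : ∀ i, MemLp (fun ω => F (θ i ω)) 2 P := fun i => by
    have h1 := hF
    rw [← hlaw i] at h1
    exact h1.comp_of_map (hθ i).aemeasurable
  have hZ : MemLp (fun ω => ∑ i, (N : ℝ)⁻¹ * F (θ i ω)) 2 P :=
    memLp_finsetSum _ fun i _ => (hY i).const_mul _
  have hcZ : MemLp (fun ω => c - ∑ i, (N : ℝ)⁻¹ * F (θ i ω)) 2 P := (memLp_const c).sub hZ
  have hEY : ∀ i, ∫ ω, F (θ i ω) ∂P = ∫ x, h x ∂κ := fun i => by
    rw [← integral_map (hθ i).aemeasurable hFm.aestronglyMeasurable, hlaw i]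
    exact integral_rnDeriv_smul hac
  have hEZ : ∫ ω, (c - ∑ i, (N : ℝ)⁻¹ * F (θ i ω)) ∂P = c - ∫ x, h x ∂κ := by
    rw [integral_sub (integrable_const c) (hZ.integrable one_le_two), integral_finsetSum _
      fun i _ => ((hY i).integrable one_le_two).const_mul _]
    simp only [integral_const_mul, hEY]
    simp [hN]
  have hVY : ∀ i, Var[fun ω => F (θ i ω); P]
      ≤ (essSup (κ.rnDeriv ν) ν).toReal * ∫ x, h x ^ 2 ∂κ := fun i => by
    refine (variance_le_expectation_sq (hY i).1).trans ?_
    refine le_trans (le_of_eq ?_) hFle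
    rw [← hlaw i, integral_map (hθ i).aemeasurable (by
      rw [hlaw i]; exact (hFm.pow_const 2).aestronglyMeasurable)]
    simp [F, hlaw i]
  have hVZ : Var[fun ω => ∑ i, (N : ℝ)⁻¹ * F (θ i ω); P]
      ≤ (essSup (κ.rnDeriv ν) ν).toReal / N * ∫ x, h x ^ 2 ∂κ := by
    have h1 : (fun ω => ∑ i, (N : ℝ)⁻¹ * F (θ i ω)) = ∑ i, fun ω => (N : ℝ)⁻¹ * F (θ i ω) := by
      ext ω
      simp
    rw [h1, IndepFun.variance_sum (fun i _ => (hY i).const_mul _)]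
    · simp only [variance_const_mul]
      calc ∑ i : Fin N, ((N : ℝ)⁻¹) ^ 2 * Var[fun ω => F (θ i ω); P]
          ≤ ∑ _i : Fin N, ((N : ℝ)⁻¹) ^ 2
              * ((essSup (κ.rnDeriv ν) ν).toReal * ∫ x, h x ^ 2 ∂κ) := by
            gcongr with i _
            exact hVY i
        _ = _ := by
            rw [Finset.sum_const, Finset.card_univ, Fintype.card_fin, nsmul_eq_mul]
            field_simp
    · intro i _ j _ hij
      have h2 := (hindep.indepFun hij).comp (φ := fun x => (N : ℝ)⁻¹ * F x)
        (ψ := fun x => (N : ℝ)⁻¹ * F x) (hFm.const_mul _) (hFm.const_mul _)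
      exact h2
  have hvar := variance_eq_sub hcZ
  rw [hEZ, variance_const_sub hZ.1] at hvar
  simp only [sq_abs]
  refine ⟨hcZ.integrable_sq, ?_⟩
  simp only [Pi.pow_apply] at hvar
  linarith

end ImportanceSampling

/-! ### The second moment of the parameters -/

section Moment

variable {p : ℝ≥0∞} {d : ℕ}

/-- The size `|w| (‖a‖² + ‖c‖² + |b|² + 1)^{1/2}` of a parameter, whose second moment is
`I_{μ,p}^{(2)}` squared. -/
noncomputable def paramSize (θ : ParamSpace p d) : ℝ :=
  |θ.1| * √(‖θ.2.1‖ ^ 2 + ‖θ.2.2.1‖ ^ 2 + ‖θ.2.2.2‖ ^ 2 + 1)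

theorem sq_paramSize (θ : ParamSpace p d) :
    paramSize θ ^ 2 = ‖θ.1‖ ^ 2 * (‖θ.2.1‖ ^ 2 + ‖θ.2.2.1‖ ^ 2 + ‖θ.2.2.2‖ ^ 2 + 1) := by
  rw [paramSize, mul_pow, Real.sq_sqrt (by positivity)]
  rfl

variable [Fact (1 ≤ p)]

theorem measurable_paramSize : Measurable (paramSize : ParamSpace p d → ℝ) := by
  unfold paramSize
  fun_prop

theorem memLp_paramSize {μ : Measure (ParamSpace p d)} (hμ : barronMoment₂ μ < ∞) :
    MemLp paramSize 2 μ ∧ ∫ θ, paramSize θ ^ 2 ∂μ = (barronMoment₂ μ).toReal ^ 2 := by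
  have hof : ∀ θ : ParamSpace p d, ENNReal.ofReal (paramSize θ ^ 2)
      = ‖θ.1‖ₑ ^ 2 * (‖θ.2.1‖ₑ ^ 2 + ‖θ.2.2.1‖ₑ ^ 2 + ‖θ.2.2.2‖ₑ ^ 2 + 1) := fun θ => by
    rw [sq_paramSize, ENNReal.ofReal_mul (by positivity),
      ENNReal.ofReal_add (by positivity) zero_le_one, ENNReal.ofReal_add (by positivity)
      (by positivity), ENNReal.ofReal_add (by positivity) (by positivity)]
    simp only [ENNReal.ofReal_pow (norm_nonneg _), ofReal_norm, ENNReal.ofReal_one]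
  have hm : AEStronglyMeasurable (fun θ : ParamSpace p d => paramSize θ ^ 2) μ :=
    (measurable_paramSize.pow_const 2).aestronglyMeasurable
  have heq : barronMoment₂ μ
      = (∫⁻ θ, ENNReal.ofReal (paramSize θ ^ 2) ∂μ) ^ (1 / 2 : ℝ) := by
    simp only [hof]
    rfl
  have hfin : ∫⁻ θ, ENNReal.ofReal (paramSize θ ^ 2) ∂μ < ∞ := by
    rw [heq] at hμ
    exact (ENNReal.rpow_lt_top_iff_of_pos (by norm_num)).1 hμ
  refine ⟨(memLp_two_iff_integrable_sq measurable_paramSize.aestronglyMeasurable).2 ⟨hm, ?_⟩, ?_⟩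
  · rwa [hasFiniteIntegral_iff_ofReal (ae_of_all _ fun θ => sq_nonneg _)]
  · rw [integral_eq_lintegral_of_nonneg_ae (ae_of_all _ fun θ => sq_nonneg _) hm, heq,
      ← ENNReal.toReal_rpow, ← Real.rpow_natCast, ← Real.rpow_mul ENNReal.toReal_nonneg]
    norm_num

theorem memLp_of_abs_le_paramSize {μ : Measure (ParamSpace p d)} (hμ : barronMoment₂ μ < ∞)
    {h : ParamSpace p d → ℝ} (hm : Measurable h) {c : ℝ}
    (hle : ∀ θ, |h θ| ≤ c * paramSize θ) :
    MemLp h 2 μ ∧ ∫ θ, h θ ^ 2 ∂μ ≤ (c * (barronMoment₂ μ).toReal) ^ 2 := by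
  obtain ⟨h1, h2⟩ := memLp_paramSize hμ
  have h3 : MemLp h 2 μ := (h1.const_mul c).mono' hm.aestronglyMeasurable (ae_of_all _ hle)
  refine ⟨h3, ?_⟩
  calc ∫ θ, h θ ^ 2 ∂μ ≤ ∫ θ, c ^ 2 * paramSize θ ^ 2 ∂μ := by
        refine integral_mono h3.integrable_sq (h1.integrable_sq.const_mul _) fun θ => ?_
        dsimp only
        rw [← mul_pow, ← sq_abs]
        gcongr
        exact hle θ
    _ = _ := by rw [integral_const_mul, h2, mul_pow]

theorem abs_integral_le_of_abs_le_paramSize {μ : Measure (ParamSpace p d)}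
    [IsProbabilityMeasure μ] (hμ : barronMoment₂ μ < ∞) {h : ParamSpace p d → ℝ}
    (hm : Measurable h) {c : ℝ} (hc : 0 ≤ c) (hle : ∀ θ, |h θ| ≤ c * paramSize θ) :
    |∫ θ, h θ ∂μ| ≤ c * (barronMoment₂ μ).toReal := by
  obtain ⟨h1, h2⟩ := memLp_of_abs_le_paramSize hμ hm hle
  exact abs_le_of_sq_le_sq ((sq_integral_le_integral_sq h1).trans h2)
    (mul_nonneg hc ENNReal.toReal_nonneg)

end Moment

/-! ### Scalar estimates -/

section Scalar

/-- Since `ε^k` decreases in `k`, the left sum is at most a partial sum of `∑ (k + 1) ε^k = (1 -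
ε)⁻²`. Two powers of `T` are gained, one of which will be spent on `N ≤ d T`. -/
theorem triangular_mul_pow_mul_le {ε : ℝ} (h0 : 0 ≤ ε) (h1 : ε ≤ 1) (n : ℕ) :
    ((n + 1) * (n + 2) / 2 : ℝ) * ε ^ n * (1 - ε) ^ 2 ≤ 1 := by
  have hsum : ∀ m : ℕ, (∑ k ∈ Finset.range m, ((k : ℝ) + 1) * ε ^ k) * (1 - ε) ^ 2
      = 1 - (m + 1) * ε ^ m + m * ε ^ (m + 1) := fun m => by
    induction m with
    | zero => simp
    | succ m ih =>
      rw [Finset.sum_range_succ, add_mul, ih]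
      push_cast
      ring
  have htri : ∀ m : ℕ, ∑ k ∈ Finset.range m, ((k : ℝ) + 1) = m * (m + 1) / 2 := fun m => by
    induction m with
    | zero => simp
    | succ m ih =>
      rw [Finset.sum_range_succ, ih]
      push_cast
      ring
  have hle : ((n + 1) * (n + 2) / 2 : ℝ) * ε ^ n
      ≤ ∑ k ∈ Finset.range (n + 1), ((k : ℝ) + 1) * ε ^ k := by
    have h2 := htri (n + 1)
    push_cast at h2
    rw [show ((n + 1) * (n + 2) / 2 : ℝ) = (n + 1) * (n + 1 + 1) / 2 by ring, ← h2,
      Finset.sum_mul]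
    refine Finset.sum_le_sum fun k hk => ?_
    gcongr ?_ * ?_
    exact pow_le_pow_of_le_one h0 h1 (Nat.lt_succ_iff.1 (Finset.mem_range.1 hk))
  calc _ ≤ (∑ k ∈ Finset.range (n + 1), ((k : ℝ) + 1) * ε ^ k) * (1 - ε) ^ 2 := by gcongr
    _ ≤ 1 := by
      rw [hsum, pow_succ ε (n + 1)]
      have h3 : 0 ≤ ε ^ (n + 1) := by positivity
      have h4 : ((n + 1 : ℕ) : ℝ) * (ε ^ (n + 1) * ε) ≤ ((n + 1 : ℕ) : ℝ) * ε ^ (n + 1) := by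
        gcongr
        exact mul_le_of_le_one_right h3 h1
      linarith

theorem one_le_one_sub_rpow_neg {r p : ℝ} (hp : 0 < p) (h0 : 0 ≤ r) (h1 : r < 1) :
    0 < 1 - r ^ p ∧ 1 - r ^ p ≤ 1 ∧ 1 ≤ (1 - r ^ p) ^ (-(1 / p)) := by
  have h2 : r ^ p < 1 := Real.rpow_lt_one h0 h1 hp
  have h3 : 0 ≤ r ^ p := Real.rpow_nonneg h0 p
  exact ⟨by linarith, by linarith, Real.one_le_rpow_of_pos_of_le_one_of_nonpos (by linarith)
    (by linarith) (by rw [neg_nonpos]; positivity)⟩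

/-- Comparison of the `ℓ²` and `ℓ^p` norms of a geometric sequence of length `T`. For `p ≤ 2` it
follows from `r² ≤ r^p`; for `p ≥ 2` the power mean inequality costs `T^(1/2 - 1/p)`. -/
theorem sqrt_sum_pow_sq_le {r p : ℝ} (hp : 1 ≤ p) (h0 : 0 ≤ r) (h1 : r < 1) {T : ℕ}
    (hT : 0 < T) :
    √(∑ k ∈ Finset.range T, (r ^ k) ^ 2)
      ≤ (T : ℝ) ^ max 0 (1 / 2 - 1 / p) * (1 - r ^ p) ^ (-(1 / p)) := by
  have hp0 : 0 < p := by linarith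
  have hT1 : (1 : ℝ) ≤ T := by exact_mod_cast hT
  obtain ⟨h2, h2', h3⟩ := one_le_one_sub_rpow_neg hp0 h0 h1
  rcases le_total p 2 with hp2 | hp2
  · have hγ : max 0 (1 / 2 - 1 / p) = 0 := by
      refine max_eq_left ?_
      rw [sub_nonpos]
      exact one_div_le_one_div_of_le hp0 hp2
    rw [hγ, Real.rpow_zero, one_mul]
    have hr2 : r ^ 2 < 1 := by nlinarith
    have hr2p : r ^ 2 ≤ r ^ p := by
      rcases eq_or_lt_of_le h0 with rfl | h0'
      · rw [Real.zero_rpow hp0.ne']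
        norm_num
      · rw [← Real.rpow_natCast]
        exact Real.rpow_le_rpow_of_exponent_ge h0' h1.le (by simpa using hp2)
    have hs : ∑ k ∈ Finset.range T, (r ^ k) ^ 2 ≤ (1 - r ^ p)⁻¹ := by
      simp only [← pow_mul, mul_comm _ 2]
      simp only [pow_mul]
      calc ∑ k ∈ Finset.range T, (r ^ 2) ^ k ≤ ∑' k : ℕ, (r ^ 2) ^ k :=
            (summable_geometric_of_lt_one (by positivity) hr2).sum_le_tsum _
              fun _ _ => by positivity
        _ = (1 - r ^ 2)⁻¹ := tsum_geometric_of_lt_one (by positivity) hr2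
        _ ≤ (1 - r ^ p)⁻¹ := by gcongr
    calc √(∑ k ∈ Finset.range T, (r ^ k) ^ 2) ≤ √((1 - r ^ p)⁻¹) := Real.sqrt_le_sqrt hs
      _ = (1 - r ^ p) ^ (-(1 / 2 : ℝ)) := by
          rw [Real.sqrt_eq_rpow, Real.inv_rpow h2.le, Real.rpow_neg h2.le]
      _ ≤ (1 - r ^ p) ^ (-(1 / p)) := by
          refine Real.rpow_le_rpow_of_exponent_ge h2 h2' ?_
          rw [neg_le_neg_iff]
          exact one_div_le_one_div_of_le hp0 hp2
  · have hγ : max 0 (1 / 2 - 1 / p) = 1 / 2 - 1 / p := by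
      refine max_eq_right ?_
      rw [sub_nonneg]
      exact one_div_le_one_div_of_le (by norm_num) hp2
    rw [hγ]
    set s := ∑ k ∈ Finset.range T, (r ^ k) ^ 2 with hs
    have hs0 : 0 ≤ s := Finset.sum_nonneg fun _ _ => by positivity
    have hrp1 : r ^ p < 1 := by linarith
    have hrp0 : 0 ≤ r ^ p := Real.rpow_nonneg h0 p
    have hpow : s ^ (p / 2) ≤ (T : ℝ) ^ (p / 2 - 1) * (1 - r ^ p)⁻¹ := by
      have h4 := Real.rpow_sum_le_const_mul_sum_rpow_of_nonneg (Finset.range T)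
        (f := fun k => (r ^ k) ^ 2) (p := p / 2) (by linarith) fun _ _ => by positivity
      rw [Finset.card_range] at h4
      refine h4.trans ?_
      gcongr
      calc ∑ k ∈ Finset.range T, ((r ^ k) ^ 2) ^ (p / 2)
          = ∑ k ∈ Finset.range T, (r ^ p) ^ k := by
            refine Finset.sum_congr rfl fun k _ => ?_
            rw [← Real.rpow_natCast (r ^ k), ← Real.rpow_mul (by positivity), ← Real.rpow_natCast r,
              ← Real.rpow_natCast (r ^ p), ← Real.rpow_mul h0, ← Real.rpow_mul h0]
            congr 1
            push_cast
            ring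
        _ ≤ ∑' k : ℕ, (r ^ p) ^ k :=
            (summable_geometric_of_lt_one hrp0 hrp1).sum_le_tsum _ fun _ _ => by positivity
        _ = (1 - r ^ p)⁻¹ := tsum_geometric_of_lt_one hrp0 hrp1
    calc √s = (s ^ (p / 2)) ^ (1 / p) := by
          rw [Real.sqrt_eq_rpow, ← Real.rpow_mul hs0]
          congr 1
          field_simp
      _ ≤ ((T : ℝ) ^ (p / 2 - 1) * (1 - r ^ p)⁻¹) ^ (1 / p) := by gcongr
      _ = (T : ℝ) ^ (1 / 2 - 1 / p) * (1 - r ^ p) ^ (-(1 / p)) := by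
          rw [Real.mul_rpow (by positivity) (by positivity), ← Real.rpow_mul (by positivity),
            Real.inv_rpow h2.le, Real.rpow_neg h2.le]
          congr 2
          field_simp

/-- The power `T^γ` can be traded for a power of `d` and an error of order `N^{-1/2}`. -/
theorem rpow_mul_le_of_mul_le_sqrt {γ y c D : ℝ} {T N d : ℕ} (hγ0 : 0 ≤ γ) (hγ : γ ≤ 1 / 2)
    (hy : 0 ≤ y) (hc : 1 ≤ c) (hd : 0 < d) (hN : 0 < N) (hNT : N ≤ d * T)
    (hTy : T * y ≤ c * √d) (hD : (d : ℝ) ^ (1 / 4 + 3 / 2 * γ) ≤ D) :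
    (T : ℝ) ^ γ * y ≤ c * D * (y + 1 / √N) := by
  have hd1 : (1 : ℝ) ≤ d := by exact_mod_cast hd
  have hN0 : (0 : ℝ) < N := by exact_mod_cast hN
  have hD0 : 0 ≤ D := le_trans (by positivity) hD
  have hNT' : (N : ℝ) ≤ d * T := by exact_mod_cast hNT
  rcases eq_or_lt_of_le hy with rfl | hy
  · rw [mul_zero]
    positivity
  -- Weighted arithmetic-geometric mean with weights `1 - 2γ` and `2γ`, where `γ ≤ 1/2` is needed.
  -- The factor left over, `T^γ y^{2γ} N^γ`, is controlled by `T y` since `N ≤ d T`.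
  have hmean : y ^ (1 - 2 * γ) * (1 / √N) ^ (2 * γ) ≤ y + 1 / √N := by
    refine (Real.geom_mean_le_arith_mean2_weighted (by linarith) (by linarith) hy.le
      (by positivity) (by ring)).trans ?_
    have h1 : (1 - 2 * γ) * y ≤ y := mul_le_of_le_one_left hy.le (by linarith)
    have h2 : 2 * γ * (1 / √(N : ℝ)) ≤ 1 / √N :=
      mul_le_of_le_one_left (by positivity) (by linarith)
    linarith
  have hmain : (T : ℝ) ^ γ * y ^ (2 * γ) * (N : ℝ) ^ γ ≤ c * D := by
    calc (T : ℝ) ^ γ * y ^ (2 * γ) * (N : ℝ) ^ γ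
        ≤ (T : ℝ) ^ γ * y ^ (2 * γ) * (d * T) ^ γ := by gcongr
      _ = (T * y) ^ (2 * γ) * (d : ℝ) ^ γ := by
          rw [Real.mul_rpow (by positivity) (by positivity),
            Real.mul_rpow (by positivity) (by positivity), two_mul,
            Real.rpow_add_of_nonneg (Nat.cast_nonneg T) hγ0 hγ0]
          ring
      _ ≤ (c * √d) ^ (2 * γ) * (d : ℝ) ^ γ := by gcongr
      _ = c ^ (2 * γ) * (d : ℝ) ^ (2 * γ) := by
          rw [Real.mul_rpow (by positivity) (by positivity), Real.sqrt_eq_rpow,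
            ← Real.rpow_mul (by positivity), mul_assoc, ← Real.rpow_add (by positivity)]
          congr 2
          ring
      -- The exponents satisfy `2γ ≤ 1` and `2γ ≤ 1/4 + 3γ/2`, both because `γ ≤ 1/2`.
      _ ≤ c ^ (1 : ℝ) * (d : ℝ) ^ (1 / 4 + 3 / 2 * γ) := by
          gcongr
          · linarith
          · linarith
      _ ≤ c * D := by
          rw [Real.rpow_one]
          gcongr
  have hNγ : (1 / √(N : ℝ)) ^ (2 * γ) = ((N : ℝ) ^ γ)⁻¹ := by
    rw [Real.sqrt_eq_rpow, one_div, Real.inv_rpow (by positivity), ← Real.rpow_mul hN0.le]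
    congr 2
    ring
  calc (T : ℝ) ^ γ * y
      = ((T : ℝ) ^ γ * y ^ (2 * γ) * (N : ℝ) ^ γ)
          * (y ^ (1 - 2 * γ) * (1 / √N) ^ (2 * γ)) := by
        have h1 : y ^ (2 * γ) * y ^ (1 - 2 * γ) = y := by
          rw [← Real.rpow_add hy]
          simp
        have h2 : (N : ℝ) ^ γ ≠ 0 := by positivity
        rw [hNγ]
        field_simp
        rw [mul_assoc, h1]
    _ ≤ c * D * (y + 1 / √N) := by gcongr

/-- If `ε ≤ l`, the missing power is paid by `l`; if `ε ≥ l`, then `l⁻¹ ε ≥ 1`. No lower bound on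
`ε` is needed. -/
theorem pow_pred_le_inv_mul_add {ε l : ℝ} (hε : 0 ≤ ε) (hl : 0 < l) {T : ℕ} (hT : 0 < T) :
    ε ^ (T - 1) ≤ l⁻¹ * (l ^ T + ε ^ T) := by
  obtain ⟨n, rfl⟩ : ∃ n, T = n + 1 := ⟨T - 1, by omega⟩
  rw [Nat.add_sub_cancel, ← div_eq_inv_mul, le_div_iff₀ hl]
  rcases le_total ε l with h | h
  · calc ε ^ n * l ≤ l ^ n * l := by gcongr
      _ ≤ _ := by rw [← pow_succ]; linarith [pow_nonneg hε (n + 1)]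
  · calc ε ^ n * l ≤ ε ^ n * ε := by gcongr
      _ ≤ _ := by rw [← pow_succ]; linarith [pow_pos hl (n + 1)]

/-- If the product of `1 + Γ`, `D` and the total rate is below `19 / 20`, then the growth of `T^γ`
is compensated by the decay of `ε^{T-1}`, since then `1 - ε ≥ Γ⁻¹` is not too small. -/
theorem rpow_mul_pow_pred_le {γ ε l Γ D s τ : ℝ} {T N d : ℕ} (hγ0 : 0 ≤ γ) (hγ : γ ≤ 1 / 2)
    (hε0 : 0 ≤ ε) (hε1 : ε < 1) (hl0 : 0 < l) (hl1 : l < 1) (hT : 0 < T) (hd : 0 < d) (hN : 0 < N)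
    (hNT : N ≤ d * T) (hD : (d : ℝ) ^ (1 / 4 + 3 / 2 * γ) ≤ D) (hΓ : 1 / (1 - ε) ≤ Γ)
    (hs : 1 / √N ≤ s) (hτ : l ^ ((N : ℝ) / d) + ε ^ T + s ≤ τ)
    (hsmall : (1 + Γ) * τ * D < 19 / 20) :
    (T : ℝ) ^ γ * ε ^ (T - 1) ≤ 361 / 200 * D * l⁻¹ * τ := by
  have hd1 : (1 : ℝ) ≤ d := by exact_mod_cast hd
  have hd0 : (0 : ℝ) < d := by exact_mod_cast hd
  have hN0 : (0 : ℝ) < N := by exact_mod_cast hN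
  have hT0 : (0 : ℝ) < T := by exact_mod_cast hT
  have hNT' : (N : ℝ) ≤ d * T := by exact_mod_cast hNT
  have h1ε : 0 < 1 - ε := by linarith
  have hΓ0 : 0 < Γ := lt_of_lt_of_le (by positivity) hΓ
  have hDd : √(√(d : ℝ)) ≤ D := by
    refine le_trans ?_ hD
    rw [Real.sqrt_eq_rpow, Real.sqrt_eq_rpow, ← Real.rpow_mul hd0.le]
    exact Real.rpow_le_rpow_of_exponent_le hd1 (by linarith)
  have hD1 : 0 < D := lt_of_lt_of_le (by positivity) hDd
  have hD2 : √(d : ℝ) ≤ D ^ 2 := by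
    rw [← Real.sq_sqrt (Real.sqrt_nonneg (d : ℝ))]
    gcongr
  have hl : 0 ≤ l ^ ((N : ℝ) / d) := by positivity
  have hεT : 0 ≤ ε ^ T := by positivity
  have hτs : s ≤ τ := by linarith
  -- The rate `τ` contains `s ≥ 1 / √N`, so smallness of `(1 + Γ) τ D` bounds `Γ D` by a multiple of
  -- `√N`.
  have hΓD : Γ * D ≤ 19 / 20 * √N := by
    have h1 : Γ * D * (1 / √N) ≤ 19 / 20 := by
      calc Γ * D * (1 / √N) ≤ (1 + Γ) * D * τ := by
            gcongr
            · linarith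
            · exact hs.trans hτs
        _ ≤ 19 / 20 := by linarith
    rwa [mul_one_div, div_le_iff₀ (by positivity)] at h1
  have hsq : Γ ^ 2 * D ^ 2 ≤ 361 / 400 * N := by
    rw [← mul_pow]
    calc (Γ * D) ^ 2 ≤ (19 / 20 * √(N : ℝ)) ^ 2 := by gcongr
      _ = 361 / 400 * (N : ℝ) := by rw [mul_pow, Real.sq_sqrt hN0.le]; norm_num
  set y := ε ^ (T - 1) with hy
  have hy0 : 0 ≤ y := by positivity
  have htri : (T : ℝ) * (T + 1) / 2 * y ≤ Γ ^ 2 := by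
    have h1 := triangular_mul_pow_mul_le hε0 hε1.le (T - 1)
    have h2 : (((T - 1 : ℕ) : ℝ) + 1) = T := by
      rw [Nat.cast_sub hT]; simp
    rw [show (((T - 1 : ℕ) : ℝ) + 2) = T + 1 by rw [← h2]; ring, h2, ← hy] at h1
    calc (T : ℝ) * (T + 1) / 2 * y ≤ 1 / (1 - ε) ^ 2 := by
          rw [le_div_iff₀ (by positivity)]
          exact h1
      _ = (1 / (1 - ε)) ^ 2 := by rw [div_pow, one_pow]
      _ ≤ Γ ^ 2 := by gcongr
  -- Here `361/200 = 2 (19/20)²`. One factor `T` cancels through `N ≤ d T`, and one `√d` through `√d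
  -- ≤ D²`.
  have hTy : (T : ℝ) * y ≤ 361 / 200 * √d := by
    have h1 : T * ((T + 1) * y * √d) ≤ T * (361 / 200 * d) := by
      calc T * ((T + 1) * y * √d) ≤ T * ((T + 1) * y * D ^ 2) := by gcongr
        _ = 2 * (T * (T + 1) / 2 * y) * D ^ 2 := by ring
        _ ≤ 2 * Γ ^ 2 * D ^ 2 := by gcongr
        _ ≤ 361 / 200 * N := by linarith
        _ ≤ 361 / 200 * (d * T) := by gcongr
        _ = _ := by ring
    have h2 := le_of_mul_le_mul_left h1 hT0
    have h3 : (T + 1) * y * √d ≤ 361 / 200 * √d * √d := by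
      rw [mul_assoc (361 / 200), Real.mul_self_sqrt hd0.le]
      exact h2
    have h4 := le_of_mul_le_mul_right h3 (by positivity)
    linarith
  have hlT : l ^ T ≤ l ^ ((N : ℝ) / d) := by
    rw [← Real.rpow_natCast]
    refine Real.rpow_le_rpow_of_exponent_ge hl0 hl1.le ?_
    rw [div_le_iff₀ hd0]
    linarith
  have hlinv : 1 ≤ l⁻¹ := (one_le_inv₀ hl0).2 hl1.le
  have hs0 : 0 ≤ s := le_trans (by positivity) hs
  calc (T : ℝ) ^ γ * y ≤ 361 / 200 * D * (y + 1 / √N) :=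
        rpow_mul_le_of_mul_le_sqrt hγ0 hγ hy0 (by norm_num) hd hN hNT hTy hD
    _ ≤ 361 / 200 * D * (l⁻¹ * (l ^ T + ε ^ T) + l⁻¹ * s) := by
        gcongr
        · exact pow_pred_le_inv_mul_add hε0 hl0 hT
        · exact hs.trans (le_mul_of_one_le_left hs0 hlinv)
    _ = 361 / 200 * D * l⁻¹ * (l ^ T + ε ^ T + s) := by ring
    _ ≤ 361 / 200 * D * l⁻¹ * τ := by
        gcongr
        linarith

end Scalar

/-! ### Neurons with perturbed arguments -/

section Neuron

theorem one_add_le_mul_sqrt {G e a c b : ℝ} (hG : 1 ≤ G) (he : 0 ≤ e)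
    (hb : 0 ≤ b) :
    1 + ((2 * G + e) * a + G * c + b) ≤ (√7 * G + e) * √(a ^ 2 + c ^ 2 + b ^ 2 + 1) := by
  -- Cauchy–Schwarz with coefficients `2, 1, 1, 1`, whose squares add up to `7`; the hints are the
  -- squares in Lagrange's identity.
  have h1 : 1 + 2 * a + c + b ≤ √7 * √(a ^ 2 + c ^ 2 + b ^ 2 + 1) := by
    rw [← Real.sqrt_mul (by norm_num)]
    refine Real.le_sqrt_of_sq_le ?_
    nlinarith [sq_nonneg (a - 2), sq_nonneg (a - 2 * c), sq_nonneg (a - 2 * b), sq_nonneg (c - b),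
      sq_nonneg (c - 1), sq_nonneg (b - 1)]
  have h2 : a ≤ √(a ^ 2 + c ^ 2 + b ^ 2 + 1) := Real.le_sqrt_of_sq_le (by nlinarith)
  calc 1 + ((2 * G + e) * a + G * c + b) ≤ G * (1 + 2 * a + c + b) + e * a := by
        nlinarith
    _ ≤ G * (√7 * √(a ^ 2 + c ^ 2 + b ^ 2 + 1)) + e * √(a ^ 2 + c ^ 2 + b ^ 2 + 1) := by gcongr
    _ = _ := by ring

variable {p : ℝ≥0∞} {d : ℕ} {σ : ℝ → ℝ} {L : ℝ≥0} {S G e : ℝ}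
  {t t' : ParamSpace p d → ℝ}

theorem abs_mul_activation_le (hσ : LipschitzWith L σ) (hL : L ≤ S) (h0 : |σ 0| ≤ S) (hG : 1 ≤ G)
    (he : 0 ≤ e) {θ : ParamSpace p d}
    (ht : |t θ| ≤ (2 * G + e) * ‖θ.2.1‖ + G * ‖θ.2.2.1‖ + ‖θ.2.2.2‖) :
    |θ.1 * σ (t θ)| ≤ S * (√7 * G + e) * paramSize θ := by
  have hS : 0 ≤ S := (abs_nonneg _).trans h0
  have h1 : |σ (t θ)| ≤ S * (1 + |t θ|) := by
    have h2 := hσ.dist_le_mul (t θ) 0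
    rw [Real.dist_eq, Real.dist_eq, sub_zero] at h2
    have h3 : |σ (t θ)| ≤ |σ (t θ) - σ 0| + |σ 0| := by
      simpa using abs_add_le (σ (t θ) - σ 0) (σ 0)
    have h4 : (L : ℝ) * |t θ| ≤ S * |t θ| := by gcongr
    linarith
  rw [abs_mul, paramSize]
  calc |θ.1| * |σ (t θ)|
      ≤ |θ.1| * (S * (1 + ((2 * G + e) * ‖θ.2.1‖ + G * ‖θ.2.2.1‖ + ‖θ.2.2.2‖))) := by
        gcongr
        exact h1.trans (by gcongr)
    _ ≤ |θ.1| * (S * ((√7 * G + e)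
          * √(‖θ.2.1‖ ^ 2 + ‖θ.2.2.1‖ ^ 2 + ‖θ.2.2.2‖ ^ 2 + 1))) := by
        gcongr
        exact one_add_le_mul_sqrt hG he (norm_nonneg _)
    _ = _ := by ring

variable [Fact (1 ≤ p)]

theorem abs_integral_activation_le {μ : Measure (ParamSpace p d)} [IsProbabilityMeasure μ]
    (hμ : barronMoment₂ μ < ∞) (hσ : LipschitzWith L σ) (hL : L ≤ S) (h0 : |σ 0| ≤ S) (hG : 1 ≤ G)
    (htm : Measurable t)
    (ht : ∀ θ, |t θ| ≤ 2 * G * ‖θ.2.1‖ + G * ‖θ.2.2.1‖ + ‖θ.2.2.2‖) :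
    |∫ θ, θ.1 * σ (t θ) ∂μ| ≤ S * (√7 * G) * (barronMoment₂ μ).toReal := by
  have hS : 0 ≤ S := (abs_nonneg _).trans h0
  refine abs_integral_le_of_abs_le_paramSize hμ
    (measurable_fst.mul (hσ.continuous.measurable.comp htm)) (by positivity) fun θ => ?_
  have := abs_mul_activation_le (t := t) (θ := θ) hσ hL h0 hG le_rfl (by simpa using ht θ)
  simpa using this

theorem integral_sq_activation_le {μ : Measure (ParamSpace p d)}
    (hμ : barronMoment₂ μ < ∞) (hσ : LipschitzWith L σ) (hL : L ≤ S) (h0 : |σ 0| ≤ S) (hG : 1 ≤ G)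
    (he : 0 ≤ e) (htm' : Measurable t')
    (ht : ∀ θ, |t θ| ≤ 2 * G * ‖θ.2.1‖ + G * ‖θ.2.2.1‖ + ‖θ.2.2.2‖)
    (ht' : ∀ θ, |t' θ - t θ| ≤ e * ‖θ.2.1‖) :
    MemLp (fun θ => θ.1 * σ (t' θ)) 2 μ ∧
      ∫ θ, (θ.1 * σ (t' θ)) ^ 2 ∂μ
        ≤ (S * (√7 * G + e) * (barronMoment₂ μ).toReal) ^ 2 := by
  refine memLp_of_abs_le_paramSize hμ
    (measurable_fst.mul (hσ.continuous.measurable.comp htm')) fun θ => ?_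
  refine abs_mul_activation_le (t := t') hσ hL h0 hG he ?_
  have h1 : |t' θ| ≤ |t' θ - t θ| + |t θ| := by simpa using abs_add_le (t' θ - t θ) (t θ)
  linarith [ht θ, ht' θ]

theorem abs_integral_activation_sub_le {μ : Measure (ParamSpace p d)} [IsProbabilityMeasure μ]
    (hμ : barronMoment₂ μ < ∞) (hσ : LipschitzWith L σ) (hL : L ≤ S) (h0 : |σ 0| ≤ S) (hG : 1 ≤ G)
    (he : 0 ≤ e) (htm : Measurable t) (htm' : Measurable t')
    (ht : ∀ θ, |t θ| ≤ 2 * G * ‖θ.2.1‖ + G * ‖θ.2.2.1‖ + ‖θ.2.2.2‖)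
    (ht' : ∀ θ, |t' θ - t θ| ≤ e * ‖θ.2.1‖) :
    |∫ θ, θ.1 * σ (t θ) ∂μ - ∫ θ, θ.1 * σ (t' θ) ∂μ| ≤ S * e * (barronMoment₂ μ).toReal := by
  have hS : 0 ≤ S := (abs_nonneg _).trans h0
  have m1 : MemLp (fun θ : ParamSpace p d => θ.1 * σ (t θ)) 2 μ :=
    (integral_sq_activation_le hμ hσ hL h0 hG le_rfl htm ht (by simp)).1
  have m2 := (integral_sq_activation_le hμ hσ hL h0 hG he htm' ht ht').1
  rw [← integral_sub (m1.integrable one_le_two) (m2.integrable one_le_two)]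
  refine abs_integral_le_of_abs_le_paramSize hμ
    ((measurable_fst.mul (hσ.continuous.measurable.comp htm)).sub
      (measurable_fst.mul (hσ.continuous.measurable.comp htm'))) (by positivity) fun θ => ?_
  have h2 := hσ.dist_le_mul (t' θ) (t θ)
  rw [Real.dist_eq, Real.dist_eq, abs_sub_comm] at h2
  have h3 : ‖θ.2.1‖ ≤ √(‖θ.2.1‖ ^ 2 + ‖θ.2.2.1‖ ^ 2 + ‖θ.2.2.2‖ ^ 2 + 1) :=
    Real.le_sqrt_of_sq_le (by nlinarith [sq_nonneg ‖θ.2.2.1‖, sq_nonneg ‖θ.2.2.2‖])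
  change |θ.1 * σ (t θ) - θ.1 * σ (t' θ)| ≤ _
  rw [← mul_sub, abs_mul, paramSize]
  calc |θ.1| * |σ (t θ) - σ (t' θ)| ≤ |θ.1| * (S * (e * ‖θ.2.1‖)) := by
        gcongr
        exact h2.trans (mul_le_mul hL (ht' θ) (abs_nonneg _) hS)
    _ ≤ |θ.1| * (S * (e * √(‖θ.2.1‖ ^ 2 + ‖θ.2.2.1‖ ^ 2 + ‖θ.2.2.2‖ ^ 2 + 1))) := by gcongr
    _ = _ := by ring

end Neuron

/-! ### The constants -/

section Constants

/-- The part of `c̃₁` that depends on the dimension. -/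
noncomputable def dimFactor (d : ℕ) (p q : ℝ) : ℝ :=
  max 1 ((d : ℝ) ^ (1 / 2 - 1 / p)) * (d : ℝ) ^ (1 / (2 * p)) * max 1 ((d : ℝ) ^ (1 / q - 1 / 2))

/-- With `u = 1/p`: for `p ≥ 2` the three exponents `1/2 - u`, `u/2`, `1/2 - u` add up to exactly
`1/4 + 3γ/2`; for `p ≤ 2` one has `γ = 0` and `u/2 ≥ 1/4` suffices. -/
theorem rpow_le_dimFactor {d : ℕ} (hd : 0 < d) {p q : ℝ} (hpq : p.HolderConjugate q) :
    (d : ℝ) ^ (1 / 4 + 3 / 2 * max 0 (1 / 2 - 1 / p)) ≤ dimFactor d p q := by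
  have hd1 : (1 : ℝ) ≤ d := by exact_mod_cast hd
  have hd0 : (0 : ℝ) < d := by linarith
  have hq : 1 / q = 1 - 1 / p := by
    have := hpq.inv_add_inv_eq_one
    simp only [one_div]
    linarith
  have h2p : 1 / (2 * p) = 1 / 2 * (1 / p) := by
    have := hpq.pos.ne'
    field_simp
  rw [dimFactor, hq, h2p]
  set u := 1 / p
  rcases le_total (1 / 2 - u) 0 with h | h
  · rw [max_eq_left h]
    calc (d : ℝ) ^ (1 / 4 + 3 / 2 * 0 : ℝ) ≤ (d : ℝ) ^ (1 / 2 * u) :=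
          Real.rpow_le_rpow_of_exponent_le hd1 (by linarith)
      _ = 1 * (d : ℝ) ^ (1 / 2 * u) * 1 := by ring
      _ ≤ _ := by
          gcongr
          · exact le_max_left _ _
          · exact le_max_left _ _
  · rw [max_eq_right h]
    calc (d : ℝ) ^ (1 / 4 + 3 / 2 * (1 / 2 - u))
        = (d : ℝ) ^ (1 / 2 - u) * (d : ℝ) ^ (1 / 2 * u) * (d : ℝ) ^ (1 - u - 1 / 2) := by
          rw [← Real.rpow_add hd0, ← Real.rpow_add hd0]
          congr 1
          ring
      _ ≤ _ := by
          gcongr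
          · exact le_max_right _ _
          · exact le_max_right _ _

/-- The left side is what the proof uses. The stated constant has to spare the factor `(1 -
λ^q)^{-1/q} ≥ 1`, one power of `max M 1`, and the maximum with `I_{μ,p}`. -/
theorem mul_le_constHESN {p q : ℝ≥0∞} [Fact (1 ≤ p)] [Fact (1 ≤ q)] {N d : ℕ} [NeZero d]
    (E : ESN N d) (hE : ‖E.A‖ < 1) (μ : Measure (ParamSpace p d))
    (A : SeqSpace q →L[ℝ] SeqSpace q) (B : SeqSpace q) (C : Vec d →L[ℝ] SeqSpace q)
    (L s₀ M : ℝ) {lam : ℝ} (h0 : 0 < lam) (h1 : lam < 1) (hq : 0 < q.toReal) :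
    √8 * lam⁻¹ * dimFactor d p.toReal q.toReal
        * (max (max L |s₀|) 1 * max M 1 * (1 - lam)⁻¹
          * max (max (‖C‖ / (1 - ‖lam⁻¹ • A‖ ^ p.toReal) ^ (1 / p.toReal)) (‖B‖ / (1 - ‖A‖))) 1
          * (barronMoment₂ μ).toReal)
        * (1 + (‖E.C‖ + ‖E.B‖) / (1 - ‖E.A‖) * ‖E.KinvTΛ lam‖)
      ≤ constHESN E μ A B C L s₀ M lam := by
  obtain ⟨-, -, hη⟩ := one_le_one_sub_rpow_neg hq h0.le h1
  have hS : 1 ≤ max (max L |s₀|) 1 := le_max_right _ _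
  have hm : 1 ≤ max M 1 := le_max_right _ _
  have hm2 : max M 1 ≤ max M 1 ^ 2 := by nlinarith
  have hκ : 0 < 1 - lam := by linarith
  have hε : 0 < 1 - ‖E.A‖ := by linarith
  have hD : 0 ≤ dimFactor d p.toReal q.toReal := by
    unfold dimFactor
    positivity
  have hΘ : 1 ≤ max (max (‖C‖ / (1 - ‖lam⁻¹ • A‖ ^ p.toReal) ^ (1 / p.toReal))
    (‖B‖ / (1 - ‖A‖))) 1 := le_max_right _ _
  have hJ : (barronMoment₂ μ).toReal ≤ max (barronMoment μ).toReal (barronMoment₂ μ).toReal :=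
    le_max_right _ _
  have hJ0 : 0 ≤ (barronMoment₂ μ).toReal := ENNReal.toReal_nonneg
  have hc : constHESN E μ A B C L s₀ M lam
      = √8 * lam⁻¹ * dimFactor d p.toReal q.toReal
        * (max (max L |s₀|) 1 * max M 1 ^ 2 * (1 - lam)⁻¹
          * max (max (‖C‖ / (1 - ‖lam⁻¹ • A‖ ^ p.toReal) ^ (1 / p.toReal)) (‖B‖ / (1 - ‖A‖))) 1
          * (max (barronMoment μ).toReal (barronMoment₂ μ).toReal))
        * (1 + (‖E.C‖ + ‖E.B‖) / (1 - ‖E.A‖) * ‖E.KinvTΛ lam‖)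
        * (1 - lam ^ q.toReal) ^ (-(1 / q.toReal)) := by
    rw [constHESN, cTilde, dimFactor, Real.sqrt_eq_rpow]
    ring
  rw [hc]
  set Θ := max (max (‖C‖ / (1 - ‖lam⁻¹ • A‖ ^ p.toReal) ^ (1 / p.toReal)) (‖B‖ / (1 - ‖A‖))) 1
  refine le_trans ?_ (le_mul_of_one_le_right ?_ hη)
  · gcongr
  · have : 0 ≤ max (barronMoment μ).toReal (barronMoment₂ μ).toReal := hJ0.trans hJ
    positivity

end Constants

/-! ### Estimates for a fixed input -/

section FixedInput

variable {p q : ℝ≥0∞} [Fact (1 ≤ p)] [Fact (1 ≤ q)] {N d : ℕ}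
  {A : SeqSpace q →L[ℝ] SeqSpace q} {B : SeqSpace q} {C : Vec d →L[ℝ] SeqSpace q}
  {lam M m Θ : ℝ} {z : InputSeq d} {x : ℕ → SeqSpace q}

theorem norm_smul_inv_lt_one (hlam : ‖A‖ < lam) : ‖lam⁻¹ • A‖ < 1 := by
  have h0 : 0 < lam := (norm_nonneg A).trans_lt hlam
  rw [norm_smul, norm_inv, Real.norm_of_nonneg h0.le, ← div_eq_inv_mul, div_lt_one h0]
  exact hlam

/-- The factor `2` on `‖a‖` comes from the two sources of the state, the input through `C` and the
constant `B`. -/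
theorem abs_target_arg_le (hpq : p.toReal.HolderConjugate q.toReal) (hlam : ‖A‖ < lam)
    (hlam_one : lam < 1) (hz : ∀ n, ‖z n‖ ≤ M) (hMm : M ≤ m) (hm : 1 ≤ m) (hΘ : 1 ≤ Θ)
    (hCΘ : ‖C‖ ≤ Θ) (hBΘ : ‖B‖ / (1 - ‖A‖) ≤ Θ)
    (hx : IsSeqState id A.toLinearMap B C.toLinearMap z x) (θ : ParamSpace p d) :
    |seqDot θ.2.1 (x 1) + inner ℝ θ.2.2.1 (z 0) + θ.2.2.2|
      ≤ 2 * (m * (1 - lam)⁻¹ * Θ) * ‖θ.2.1‖ + m * (1 - lam)⁻¹ * Θ * ‖θ.2.2.1‖ + ‖θ.2.2.2‖ := by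
  have hA : ‖A‖ < 1 := hlam.trans hlam_one
  have hM0 : 0 ≤ M := (norm_nonneg _).trans (hz 0)
  have hκ0 : 0 < 1 - lam := by linarith
  have hκ : 1 ≤ (1 - lam)⁻¹ := (one_le_inv₀ hκ0).2 (by linarith [(norm_nonneg A).trans_lt hlam])
  have hAκ : (1 - ‖A‖)⁻¹ ≤ (1 - lam)⁻¹ := inv_anti₀ hκ0 (by linarith)
  have hG : m ≤ m * (1 - lam)⁻¹ * Θ := by
    rw [mul_assoc]
    exact le_mul_of_one_le_right (by linarith) (one_le_mul_of_one_le_of_one_le hκ hΘ)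
  have hx1 : ‖x 1‖ ≤ 2 * (m * (1 - lam)⁻¹ * Θ) := by
    have h1 : ‖x 1‖ ≤ (‖C‖ * M + ‖B‖) / (1 - ‖A‖) := by
      refine norm_le_of_bounded_state hA hx.bounded
        (fun n => by rw [hx.step_id n, add_assoc]) (fun n => ?_) 1
      refine (norm_add_le _ _).trans (add_le_add_left ((C.le_opNorm _).trans ?_) _)
      gcongr
      exact hz n
    have h2 : ‖C‖ * M / (1 - ‖A‖) ≤ m * (1 - lam)⁻¹ * Θ := by
      calc ‖C‖ * M / (1 - ‖A‖) = M * (1 - ‖A‖)⁻¹ * ‖C‖ := by ring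
        _ ≤ m * (1 - lam)⁻¹ * Θ := by gcongr
    have h3 : Θ ≤ m * (1 - lam)⁻¹ * Θ :=
      le_mul_of_one_le_left (by linarith) (one_le_mul_of_one_le_of_one_le hm hκ)
    rw [add_div] at h1
    linarith
  have h1 : |seqDot θ.2.1 (x 1)| ≤ 2 * (m * (1 - lam)⁻¹ * Θ) * ‖θ.2.1‖ := by
    rw [mul_comm _ ‖θ.2.1‖]
    exact (abs_seqDot_le hpq _ _).trans (by gcongr)
  have h2 : |inner ℝ θ.2.2.1 (z 0)| ≤ m * (1 - lam)⁻¹ * Θ * ‖θ.2.2.1‖ := by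
    rw [mul_comm _ ‖θ.2.2.1‖]
    exact (abs_real_inner_le_norm _ _).trans (by gcongr; exact ((hz 0).trans hMm).trans hG)
  refine (abs_add_le _ _).trans (add_le_add ((abs_add_le _ _).trans (add_le_add h1 h2)) le_rfl)

theorem abs_transfer_arg_sub_le [NeZero d] [NeZero N] (hpq : p.toReal.HolderConjugate q.toReal)
    {E : ESN N d} (hE : ‖E.A‖ < 1) (hK : IsUnit E.K) (hlam : ‖A‖ < lam)
    (hlam_one : lam < 1) (hz : ∀ n, ‖z n‖ ≤ M) (hMm : M ≤ m) (hm : 1 ≤ m)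
    (hCΘ : ‖C‖ / (1 - ‖lam⁻¹ • A‖ ^ p.toReal) ^ (1 / p.toReal) ≤ Θ)
    (hx : IsSeqState id A.toLinearMap B C.toLinearMap z x) {y : ℕ → Vec N}
    (hy : E.IsState id z y) (θ : ParamSpace p d) :
    |inner ℝ (psi E A B C lam θ).2.1 (y 1) + inner ℝ (psi E A B C lam θ).2.2.1 (z 0)
        + (psi E A B C lam θ).2.2.2
        - (seqDot θ.2.1 (x 1) + inner ℝ θ.2.2.1 (z 0) + θ.2.2.2)|
      ≤ m * (1 - lam)⁻¹ * Θ * (lam⁻¹ * lam ^ ((N : ℝ) / d)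
          + (‖E.C‖ + ‖E.B‖) / (1 - ‖E.A‖) * ‖E.KinvTΛ lam‖
            * ((horizon N d : ℝ) ^ max 0 (1 / 2 - 1 / p.toReal) * ‖E.A‖ ^ (horizon N d - 1)))
        * ‖θ.2.1‖ := by
  have hA : ‖A‖ < 1 := hlam.trans hlam_one
  have hlam0 : 0 < lam := (norm_nonneg A).trans_lt hlam
  have hM0 : 0 ≤ M := (norm_nonneg _).trans (hz 0)
  have hκ0 : 0 < 1 - lam := by linarith
  have hκ : 1 ≤ (1 - lam)⁻¹ := (one_le_inv₀ hκ0).2 (by linarith)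
  have hAκ : (1 - ‖A‖)⁻¹ ≤ (1 - lam)⁻¹ := inv_anti₀ hκ0 (by linarith)
  have hε : 0 < 1 - ‖E.A‖ := by linarith
  have hd0 : (0 : ℝ) < d := by exact_mod_cast Nat.pos_of_ne_zero (NeZero.ne d)
  have hT : 0 < horizon N d := horizon_pos
  obtain ⟨hr1, -, hr3⟩ := one_le_one_sub_rpow_neg hpq.pos (norm_nonneg (lam⁻¹ • A))
    (norm_smul_inv_lt_one hlam)
  rw [div_eq_mul_inv, ← Real.rpow_neg hr1.le] at hCΘ
  set ρ := (1 - ‖lam⁻¹ • A‖ ^ p.toReal) ^ (-(1 / p.toReal)) with hρ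
  have hC : ‖C‖ ≤ Θ := (le_mul_of_one_le_right (norm_nonneg _) hr3).trans hCΘ
  have hΘ0 : 0 ≤ Θ := (norm_nonneg _).trans hC
  set γ := max 0 (1 / 2 - 1 / p.toReal)
  -- The lost power of `‖A‖` costs only `λ⁻¹`, because `‖A‖ ≤ λ`; and `T ≥ N/d`.
  have hpow : ‖A‖ ^ (horizon N d - 1) ≤ lam⁻¹ * lam ^ ((N : ℝ) / d) := by
    have h1 : lam ^ horizon N d ≤ lam ^ ((N : ℝ) / d) := by
      rw [← Real.rpow_natCast]
      exact Real.rpow_le_rpow_of_exponent_ge hlam0 hlam_one.le (Nat.le_ceil _)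
    calc ‖A‖ ^ (horizon N d - 1) ≤ lam ^ (horizon N d - 1) := by gcongr
      _ = lam⁻¹ * lam ^ horizon N d := by
          rw [← Nat.sub_add_cancel (show 1 ≤ horizon N d from hT), pow_succ, Nat.add_sub_cancel]
          field_simp
      _ ≤ _ := by gcongr
  have h1 : ‖A‖ ^ (horizon N d - 1) * (‖C‖ * M / (1 - ‖A‖))
      ≤ m * (1 - lam)⁻¹ * Θ * (lam⁻¹ * lam ^ ((N : ℝ) / d)) := by
    calc ‖A‖ ^ (horizon N d - 1) * (‖C‖ * M / (1 - ‖A‖))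
        = M * (1 - ‖A‖)⁻¹ * ‖C‖ * ‖A‖ ^ (horizon N d - 1) := by ring
      _ ≤ _ := by gcongr
  have h2 : ‖transferVec E A C lam θ.2.1‖
      ≤ ‖E.KinvTΛ lam‖ * (‖θ.2.1‖ * (Θ * (horizon N d : ℝ) ^ γ)) := by
    refine (norm_transferVec_le hpq E A C lam θ.2.1 le_mul_horizon).trans ?_
    gcongr ?_ * ?_
    rw [mul_assoc]
    gcongr ?_ * ?_
    calc ‖C‖ * √(∑ k ∈ Finset.range (horizon N d), (‖lam⁻¹ • A‖ ^ k) ^ 2)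
        ≤ ‖C‖ * ((horizon N d : ℝ) ^ γ * ρ) := by
          gcongr
          exact sqrt_sum_pow_sq_le hpq.lt.le (norm_nonneg _) (norm_smul_inv_lt_one hlam) hT
      _ = ‖C‖ * ρ * (horizon N d : ℝ) ^ γ := by ring
      _ ≤ _ := by gcongr
  have h3 : (‖E.C‖ * M + ‖E.B‖) / (1 - ‖E.A‖)
      ≤ m * (1 - lam)⁻¹ * ((‖E.C‖ + ‖E.B‖) / (1 - ‖E.A‖)) := by
    have h4 : ‖E.C‖ * M + ‖E.B‖ ≤ m * (‖E.C‖ + ‖E.B‖) := by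
      have h5 : ‖E.C‖ * M ≤ ‖E.C‖ * m := by gcongr
      have h6 : ‖E.B‖ ≤ m * ‖E.B‖ := le_mul_of_one_le_left (norm_nonneg _) hm
      linarith
    calc (‖E.C‖ * M + ‖E.B‖) / (1 - ‖E.A‖) ≤ m * 1 * ((‖E.C‖ + ‖E.B‖) / (1 - ‖E.A‖)) := by
          rw [mul_one, ← mul_div_assoc]
          gcongr
      _ ≤ _ := by gcongr
  have hval := abs_psi_arg_sub_le hpq hE hK hA hlam0.ne' hz hx hy θ
  have hc : (psi E A B C lam θ).2.2.1 = θ.2.2.1 := rfl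
  rw [hc]
  have hre : inner ℝ (psi E A B C lam θ).2.1 (y 1) + inner ℝ θ.2.2.1 (z 0)
        + (psi E A B C lam θ).2.2.2 - (seqDot θ.2.1 (x 1) + inner ℝ θ.2.2.1 (z 0) + θ.2.2.2)
      = inner ℝ (psi E A B C lam θ).2.1 (y 1) + (psi E A B C lam θ).2.2.2
        - (seqDot θ.2.1 (x 1) + θ.2.2.2) := by ring
  rw [hre]
  calc _ ≤ _ := hval
    _ ≤ ‖θ.2.1‖ * (m * (1 - lam)⁻¹ * Θ * (lam⁻¹ * lam ^ ((N : ℝ) / d)))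
        + ‖E.KinvTΛ lam‖ * (‖θ.2.1‖ * (Θ * (horizon N d : ℝ) ^ γ))
          * (‖E.A‖ ^ (horizon N d - 1)
            * (m * (1 - lam)⁻¹ * ((‖E.C‖ + ‖E.B‖) / (1 - ‖E.A‖)))) := by gcongr
    _ = _ := by ring

end FixedInput

/-- The comparison of the error of the importance sampling estimator with the claimed rate. -/
theorem sampling_error_le_rate {W D li l s e Γ τ u : ℝ} (hW : 0 ≤ W) (hD : 1 ≤ D) (hli : 1 ≤ li)
    (hl : 0 ≤ l) (he : 0 ≤ e) (hs : 0 ≤ s) (hΓ : 1 ≤ Γ) (hτ : τ = l + e + s)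
    (hu0 : 0 ≤ u) (hu : u ≤ 361 / 200 * D * li * τ) (hsmall : (1 + Γ) * τ * D < 19 / 20) :
    W * (li * l + Γ * u) + s * (W * (√7 + (li * l + Γ * u))) ≤ √8 * li * D * W * (1 + Γ) * τ := by
  have hτ0 : 0 ≤ τ := by rw [hτ]; positivity
  -- Because `1 + Γ ≥ 2` and `D ≥ 1`, smallness forces `2 τ ≤ 19/20`.
  have hs' : s ≤ 19 / 40 := by
    have h1 : 2 * τ * 1 ≤ (1 + Γ) * τ * D := by
      gcongr
      linarith
    have h2 : s ≤ τ := by rw [hτ]; linarith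
    linarith
  have h7 : √7 ≤ √8 := Real.sqrt_le_sqrt (by norm_num)
  -- The value `27/10` lies between `(59/40) (361/200) ≈ 2.66`, needed for the term with `Γ u`, and
  -- `√8`.
  have h8 : (27 / 10 : ℝ) ≤ √8 := Real.le_sqrt_of_sq_le (by norm_num)
  have hliD : 1 ≤ li * D := one_le_mul_of_one_le_of_one_le hli hD
  have hX : 0 ≤ li * l + Γ * u := by positivity
  have h1 : (1 + s) * (li * l) ≤ √8 * li * D * l := by
    calc (1 + s) * (li * l) ≤ √8 * (li * l) := by
          gcongr
          linarith
      _ = √8 * li * 1 * l := by ring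
      _ ≤ √8 * li * D * l := by gcongr
  have h2 : s * √7 ≤ √8 * li * D * s := by
    calc s * √7 ≤ s * √8 := by gcongr
      _ = √8 * 1 * s := by ring
      _ ≤ √8 * (li * D) * s := by gcongr
      _ = √8 * li * D * s := by ring
  have h3 : (1 + s) * (Γ * u) ≤ √8 * li * D * Γ * τ := by
    calc (1 + s) * (Γ * u) ≤ (1 + 19 / 40) * (Γ * (361 / 200 * D * li * τ)) := by gcongr
      _ = (59 / 40 * (361 / 200)) * (li * D * Γ * τ) := by ring
      _ ≤ √8 * (li * D * Γ * τ) := by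
          gcongr
          linarith
      _ = _ := by ring
  have h4 : 0 ≤ √8 * li * D * e := by positivity
  calc W * (li * l + Γ * u) + s * (W * (√7 + (li * l + Γ * u)))
      = W * ((1 + s) * (li * l) + s * √7 + (1 + s) * (Γ * u)) := by ring
    _ ≤ W * (√8 * li * D * l + √8 * li * D * s + √8 * li * D * e + √8 * li * D * Γ * τ) := by
        refine mul_le_mul_of_nonneg_left ?_ hW
        linarith
    _ = √8 * li * D * W * (1 + Γ) * τ := by rw [hτ]; ring

theorem rpow_half_le_add {v b s w : ℝ} (hb : 0 ≤ b) (hs : 0 ≤ s) (hw : 0 ≤ w)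
    (h : v ≤ b ^ 2 + s ^ 2 * w ^ 2) : v ^ (1 / 2 : ℝ) ≤ b + s * w := by
  rw [← Real.sqrt_eq_rpow]
  refine Real.sqrt_le_iff.2 ⟨by positivity, h.trans ?_⟩
  nlinarith [mul_nonneg hb (mul_nonneg hs hw)]

theorem theorem3p6
    {p q : ℝ≥0∞} [Fact (1 ≤ p)] [Fact (1 ≤ q)] [ENNReal.HolderConjugate p q]
    (hp_one : 1 < p) (hp_top : p < ∞)
    {d N : ℕ} [NeZero d] [NeZero N]
    -- the activation functions: `σ₁ = id`, and `σ₂` is Lipschitz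
    (σ₂ : ℝ → ℝ) (L : ℝ≥0) (hσ₂ : LipschitzWith L σ₂)
    -- the bounded input set `D` and the inputs `I ⊆ D^{ℤ₋}`
    (D : Set (Vec d)) (M : ℝ) (hM : ∀ u ∈ D, ‖u‖ ≤ M)
    (I : Set (InputSeq d)) (hI : ∀ z ∈ I, ∀ n, z n ∈ D)
    -- the target functional and its realization
    (H : InputSeq d → ℝ) (μ : Measure (ParamSpace p d))
    (A : SeqSpace q →L[ℝ] SeqSpace q) (B : SeqSpace q) (C : Vec d →L[ℝ] SeqSpace q)
    (hH : IsBarronRealization id σ₂ I H μ A.toLinearMap B C.toLinearMap)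
    (hA : ‖A‖ < 1) (hμ : barronMoment₂ μ < ∞)
    (lam : ℝ) (hlam : ‖A‖ < lam) (hlam_one : lam < 1)
    -- the echo state network
    (E : ESN N d) (hE : ‖E.A‖ < 1) (hK : IsUnit E.K)
    -- the law of the weights of the extreme learning machine
    (ν : Measure (FinParamSpace N d)) [IsProbabilityMeasure ν]
    (hac : muABC E μ A B C lam ≪ ν)
    (hbdd : essSup ((muABC E μ A B C lam).rnDeriv ν) ν < ∞)
    -- the i.i.d. weights
    {Ω : Type*} [MeasurableSpace Ω] (P : Measure Ω) [IsProbabilityMeasure P]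
    (θ : Fin N → Ω → FinParamSpace N d) (hθ : ∀ i, Measurable (θ i))
    (hindep : iIndepFun θ P) (hlaw : ∀ i, P.map (θ i) = ν) :
    ∃ f : (Fin N → FinParamSpace N d) → (Fin N → ℝ), Measurable f ∧
      ∀ z ∈ I, (∃! x : ℕ → Vec N, E.IsState id z x) ∧
        ∀ x : ℕ → Vec N, E.IsState id z x →
          Integrable (fun ω =>
            |H z - elmOutput σ₂ (f fun i => θ i ω) (fun i => θ i ω) (x 1) (z 0)| ^ 2) P ∧
          (∫ ω, |H z - elmOutput σ₂ (f fun i => θ i ω) (fun i => θ i ω) (x 1) (z 0)| ^ 2 ∂P)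
              ^ (1 / 2 : ℝ)
            ≤ constHESN E μ A B C L (σ₂ 0) M lam *
              (lam ^ ((N : ℝ) / d) + ‖E.A‖ ^ horizon N d
                + 1 / (N : ℝ) ^ (1 / 2 : ℝ)
                  * (essSup ((muABC E μ A B C lam).rnDeriv ν) ν).toReal ^ (1 / 2 : ℝ)) := by
  have hprob := hH.isProbabilityMeasure
  have hpq : p.toReal.HolderConjugate q.toReal :=
    ENNReal.HolderConjugate.toReal
      (by simpa using (ENNReal.toReal_lt_toReal ENNReal.one_ne_top hp_top.ne).2 hp_one)
  have hlam0 : 0 < lam := (norm_nonneg A).trans_lt hlam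
  have hd : 0 < d := Nat.pos_of_ne_zero (NeZero.ne d)
  have hN : 0 < N := Nat.pos_of_ne_zero (NeZero.ne N)
  have hN0 : (0 : ℝ) < N := by exact_mod_cast hN
  have hψ : Measurable (psi E A B C lam : ParamSpace p d → FinParamSpace N d) :=
    measurable_psi hpq E A B C lam
  set κ := muABC E μ A B C lam with hκdef
  have hκprob : IsProbabilityMeasure κ := Measure.isProbabilityMeasure_map hψ.aemeasurable
  set g := (essSup (κ.rnDeriv ν) ν).toReal with hg
  have hg1 : 1 ≤ g := by
    have := ENNReal.toReal_mono hbdd.ne (one_le_essSup_rnDeriv κ ν hac)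
    simpa using this
  set s := 1 / (N : ℝ) ^ (1 / 2 : ℝ) * g ^ (1 / 2 : ℝ) with hs
  have hs0 : 0 ≤ s := by positivity
  have hs2 : s ^ 2 = g / N := by
    rw [hs, ← Real.sqrt_eq_rpow, ← Real.sqrt_eq_rpow, mul_pow, div_pow,
      Real.sq_sqrt (by positivity), Real.sq_sqrt (by positivity)]
    ring
  have hsN : 1 / √N ≤ s := by
    rw [hs, ← Real.sqrt_eq_rpow, ← Real.sqrt_eq_rpow]
    exact le_mul_of_one_le_right (by positivity) (Real.one_le_sqrt.2 hg1)
  set τ := lam ^ ((N : ℝ) / d) + ‖E.A‖ ^ horizon N d + s with hτ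
  have hε : 0 < 1 - ‖E.A‖ := by linarith
  set Γ := (‖E.C‖ + ‖E.B‖) / (1 - ‖E.A‖) * ‖E.KinvTΛ lam‖ with hΓdef
  have hΓ : 1 / (1 - ‖E.A‖) ≤ Γ := by
    rw [hΓdef, div_mul_eq_mul_div]
    gcongr
    have h1 := E.one_le_norm_KinvTΛ_mul_norm_C hK lam
    nlinarith [mul_nonneg (norm_nonneg E.B) (norm_nonneg (E.KinvTΛ lam))]
  have hΓ1 : 1 ≤ Γ := by
    refine le_trans ?_ hΓ
    rw [le_div_iff₀ hε]
    linarith [norm_nonneg E.A]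
  have hconst := mul_le_constHESN E hE μ A B C L (σ₂ 0) M hlam0 hlam_one hpq.symm.pos
  set S := max (max (L : ℝ) |σ₂ 0|) 1
  set m := max M 1
  set Θ := max (max (‖C‖ / (1 - ‖lam⁻¹ • A‖ ^ p.toReal) ^ (1 / p.toReal)) (‖B‖ / (1 - ‖A‖))) 1
  set Dd := dimFactor d p.toReal q.toReal
  set γ := max 0 (1 / 2 - 1 / p.toReal) with hγ
  have hDd : (d : ℝ) ^ (1 / 4 + 3 / 2 * γ) ≤ Dd := rpow_le_dimFactor hd hpq
  have hγ0 : 0 ≤ γ := le_max_left _ _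
  have hγ2 : γ ≤ 1 / 2 := max_le (by norm_num) (by
    have : 0 < 1 / p.toReal := one_div_pos.2 hpq.pos
    linarith)
  have hDd1 : 1 ≤ Dd := le_trans
    (Real.one_le_rpow (by exact_mod_cast hd) (by positivity)) hDd
  have hL : (L : ℝ) ≤ S := (le_max_left _ _).trans (le_max_left _ _)
  have hσ0 : |σ₂ 0| ≤ S := (le_max_right _ _).trans (le_max_left _ _)
  have hm : 1 ≤ m := le_max_right _ _
  have hMm : M ≤ m := le_max_left _ _
  have hΘ : 1 ≤ Θ := le_max_right _ _
  have hCΘ : ‖C‖ / (1 - ‖lam⁻¹ • A‖ ^ p.toReal) ^ (1 / p.toReal) ≤ Θ :=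
    (le_max_left _ _).trans (le_max_left _ _)
  have hBΘ : ‖B‖ / (1 - ‖A‖) ≤ Θ := (le_max_right _ _).trans (le_max_left _ _)
  have hCΘ' : ‖C‖ ≤ Θ := by
    obtain ⟨h1, -, h3⟩ := one_le_one_sub_rpow_neg hpq.pos (norm_nonneg (lam⁻¹ • A))
      (norm_smul_inv_lt_one hlam)
    rw [div_eq_mul_inv, ← Real.rpow_neg h1.le] at hCΘ
    exact (le_mul_of_one_le_right (norm_nonneg _) h3).trans hCΘ
  have hκ0 : 0 < 1 - lam := by linarith
  have hκ1 : 1 ≤ (1 - lam)⁻¹ := (one_le_inv₀ hκ0).2 (by linarith)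
  have hli : 1 ≤ lam⁻¹ := (one_le_inv₀ hlam0).2 hlam_one.le
  have hG : 1 ≤ m * (1 - lam)⁻¹ * Θ :=
    one_le_mul_of_one_le_of_one_le (one_le_mul_of_one_le_of_one_le hm hκ1) hΘ
  have hS1 : 1 ≤ S := le_max_right _ _
  set J := (barronMoment₂ μ).toReal with hJ
  have hJ0 : 0 ≤ J := ENNReal.toReal_nonneg
  set W := S * m * (1 - lam)⁻¹ * Θ * J with hWdef
  have hW : 0 ≤ W := by positivity
  have hl0 : 0 ≤ lam ^ ((N : ℝ) / d) := by positivity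
  have hτ0 : 0 ≤ τ := by positivity
  have hzM : ∀ z ∈ I, ∀ n, ‖z n‖ ≤ M := fun z hz n => hM _ (hI z hz n)
  have htm : ∀ (x : SeqSpace q) (z₀ : Vec d),
      Measurable fun θ : ParamSpace p d => seqDot θ.2.1 x + inner ℝ θ.2.2.1 z₀ + θ.2.2.2 :=
    fun x z₀ => by
      have h1 := (continuous_seqDot_left (p := p) hpq x).measurable
      fun_prop
  -- The threshold `19/20` serves both cases: `√7 ≤ (19/20) √8` for the zero readout, and `(1 +
  -- 19/40) · 2 (19/20)² ≤ √8` for the estimator.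
  by_cases hsmall : (1 + Γ) * τ * Dd < 19 / 20
  · -- the importance sampling estimator
    have hκm : Measurable fun ϑ => (κ.rnDeriv ν ϑ).toReal :=
      (Measure.measurable_rnDeriv κ ν).ennreal_toReal
    -- The input enters only through `σ₂`, so the readout consists of the density and the weight `w`
    -- and is the same for all `z`.
    refine ⟨fun ϑ i => (N : ℝ)⁻¹ * ((κ.rnDeriv ν (ϑ i)).toReal * (ϑ i).1), by fun_prop,
      fun z hz => ⟨E.existsUnique_isState_id hE (hzM z hz), fun y hy => ?_⟩⟩
    obtain ⟨x, hx, -⟩ := hH.existsUnique_state z hz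
    have hT := rpow_mul_pow_pred_le hγ0 hγ2 (norm_nonneg E.A) hE hlam0 hlam_one
      (horizon_pos (N := N) (d := d)) hd hN le_mul_horizon hDd hΓ hsN le_rfl hsmall
    set u := (horizon N d : ℝ) ^ γ * ‖E.A‖ ^ (horizon N d - 1) with hu
    have hu0 : 0 ≤ u := by positivity
    set e := m * (1 - lam)⁻¹ * Θ * (lam⁻¹ * lam ^ ((N : ℝ) / d) + Γ * u) with he
    have he0 : 0 ≤ e := by positivity
    let h : FinParamSpace N d → ℝ := fun ϑ =>
      ϑ.1 * σ₂ (inner ℝ ϑ.2.1 (y 1) + inner ℝ ϑ.2.2.1 (z 0) + ϑ.2.2.2)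
    have hargm : Measurable fun ϑ : FinParamSpace N d =>
        inner ℝ ϑ.2.1 (y 1) + inner ℝ ϑ.2.2.1 (z 0) + ϑ.2.2.2 := by fun_prop
    have hhm : Measurable h := measurable_fst.mul (hσ₂.continuous.measurable.comp hargm)
    have ht := abs_target_arg_le (p := p) hpq hlam hlam_one (hzM z hz) hMm hm hΘ hCΘ' hBΘ hx
    have ht' := abs_transfer_arg_sub_le (p := p) hpq hE hK hlam hlam_one (hzM z hz) hMm hm hCΘ
      hx hy
    obtain ⟨hLp, hsq⟩ := integral_sq_activation_le hμ hσ₂ hL hσ0 hG he0 (hargm.comp hψ) ht ht'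
    have hbias := abs_integral_activation_sub_le hμ hσ₂ hL hσ0 hG he0 (htm (x 1) (z 0))
      (hargm.comp hψ) ht ht'
    have hLpκ : MemLp h 2 κ :=
      (memLp_map_measure_iff hhm.aestronglyMeasurable hψ.aemeasurable).2 hLp
    have hmean : ∫ ϑ, h ϑ ∂κ = ∫ θ, h (psi E A B C lam θ) ∂μ :=
      integral_map hψ.aemeasurable hhm.aestronglyMeasurable
    have hmean2 : ∫ ϑ, h ϑ ^ 2 ∂κ = ∫ θ, h (psi E A B C lam θ) ^ 2 ∂μ :=
      integral_map hψ.aemeasurable (hhm.pow_const 2).aestronglyMeasurable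
    rw [← hH.repr z hz x hx] at hbias
    have hout : ∀ ω, elmOutput σ₂ (fun i => (N : ℝ)⁻¹ *
          ((κ.rnDeriv ν (θ i ω)).toReal * (θ i ω).1)) (fun i => θ i ω) (y 1) (z 0)
        = ∑ i, (N : ℝ)⁻¹ * ((κ.rnDeriv ν (θ i ω)).toReal * h (θ i ω)) := fun ω =>
      Finset.sum_congr rfl fun i _ => by simp only [h]; ring
    simp only [hout]
    obtain ⟨hint, hle⟩ := importance_sampling_mse_le hac hbdd hhm hLpκ hθ hindep hlaw (H z)
    refine ⟨hint, ?_⟩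
    have hb : (H z - ∫ ϑ, h ϑ ∂κ) ^ 2 ≤ (S * e * J) ^ 2 := by
      rw [← sq_abs, hmean]
      gcongr
      exact hbias
    have hv : ∫ ϑ, h ϑ ^ 2 ∂κ ≤ (S * (√7 * (m * (1 - lam)⁻¹ * Θ) + e) * J) ^ 2 := by
      rw [hmean2]
      exact hsq
    calc _ ≤ S * e * J + s * (S * (√7 * (m * (1 - lam)⁻¹ * Θ) + e) * J) := by
          refine rpow_half_le_add (by positivity) hs0 (by positivity) (hle.trans ?_)
          rw [hs2]
          gcongr
      _ = W * (lam⁻¹ * lam ^ ((N : ℝ) / d) + Γ * u)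
          + s * (W * (√7 + (lam⁻¹ * lam ^ ((N : ℝ) / d) + Γ * u))) := by
          rw [he, hWdef]
          ring
      _ ≤ √8 * lam⁻¹ * Dd * W * (1 + Γ) * τ :=
          sampling_error_le_rate hW hDd1 hli hl0 (by positivity) hs0 hΓ1 hτ hu0 hT hsmall
      _ ≤ _ := by gcongr
  · -- the claimed bound exceeds the size of `H`, and the zero readout suffices
    refine ⟨fun _ => 0, measurable_const,
      fun z hz => ⟨E.existsUnique_isState_id hE (hzM z hz), fun y _ => ?_⟩⟩
    obtain ⟨x, hx, -⟩ := hH.existsUnique_state z hz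
    have hHz : |H z| ≤ S * (√7 * (m * (1 - lam)⁻¹ * Θ)) * J := by
      rw [hH.repr z hz x hx]
      exact abs_integral_activation_le hμ hσ₂ hL hσ0 hG (htm (x 1) (z 0))
        (abs_target_arg_le hpq hlam hlam_one (hzM z hz) hMm hm hΘ hCΘ' hBΘ hx)
    have hz0 : ∀ ω, elmOutput σ₂ 0 (fun i => θ i ω) (y 1) (z 0) = 0 := fun ω => by
      simp [elmOutput]
    simp only [hz0, sub_zero]
    refine ⟨integrable_const _, ?_⟩
    rw [integral_const, probReal_univ, one_smul, ← Real.sqrt_eq_rpow,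
      Real.sqrt_sq (abs_nonneg _)]
    have h78 : √7 ≤ √8 * (19 / 20) := by
      refine Real.sqrt_le_iff.2 ⟨by positivity, ?_⟩
      rw [mul_pow, Real.sq_sqrt (by norm_num)]
      norm_num
    calc |H z| ≤ √7 * W := hHz.trans (le_of_eq (by rw [hWdef]; ring))
      _ ≤ √8 * ((1 + Γ) * τ * Dd) * W := by
          gcongr
          refine h78.trans ?_
          gcongr
          exact not_lt.1 hsmall
      _ = √8 * 1 * Dd * W * (1 + Γ) * τ := by ring
      _ ≤ √8 * lam⁻¹ * Dd * W * (1 + Γ) * τ := by gcongr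
      _ ≤ _ := by gcongr
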